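/- **Setting.** Fix an integer $J\ge 1$, real polynomials $g^{(0)},\dots,g^{(2J-1)}$ and a weight $\nu\ge 1$. Let $\ell^1_\nu$ be the Banach space of sequences $a\in\mathbb C^{\mathbb Z}$ with $\|a\|=\sum_n |a_n|\nu^{|n|}<\infty$, identified with functions $\sum_n a_ne^{inx}$; $(a*b)_n=\sum_m a_mb_{n-m}$, and for a polynomial $p$, $p(a)$ is computed with convolution powers. Put $(\mathcal D^ja)_n=(in)^ja_n$ and $$F(u)=(-1)^{J+1}\mathcal D^{2J}u+\sum_{j=0}^{2J-1}\mathcal D^j g^{(j)}(u),\qquad DF(u)h=(-1)^{J+1}\mathcal D^{2J}h+\sum_{j=0}^{2J-1}\mathcal D^j\big((g^{(j)})'(u)*h\big),$$ the right-hand side, in Fourier coefficients, of $\partial_tu=(-1)^{J+1}\partial_x^{2J}u+\sum_{j<2J}\partial_x^jg^{(j)}(u)$ on $\mathbb R/2\pi\mathbb Z$ and its linearization. A steady state is a $u\in\ell^1_\nu$ with $F(u)=0$. The operator $DF(u)$ is regarded as an unbounded operator in $\ell^1_\nu$ with domain $\{h\in\ell^1_\nu: DF(u)h\in\ell^1_\nu\}$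 (at a steady state this is $\{h\in\ell^1_\nu:\mathcal D^{2J}h\in\ell^1_\nu\}$). Let $\bar u,u^{\mathrm{in}}\in\ell^1_\nu$ and $\bar v_0^{(j)}=\big((g^{(j)})'(\bar u)\big)_0$. Let $N\in\mathbb N$, let $Q$ be an invertible complex matrix indexed by the modes $|n|\le N$, extended to all modes by the identity, and let $\Lambda=\operatorname{diag}(\lambda_n)_{n\in\mathbb Z}$ where $\lambda_n\in\mathbb C$ is arbitrary for $|n|\le N$ and $\lambda_n=-n^{2J}+\sum_{j<2J}(in)^j\bar v^{(j)}_0$ for $|n|>N$. Put $\mathcal L=Q\Lambda Q^{-1}$ and $\gamma(u)=F(u)-\mathcal Lu$. **Bounds.** Absolute values of sequences and matrices are entrywise, $\Pi^{\le K}$ is the projection onto the modes $|n|\le K$, and matrices carry the operator norm of $\ell^1_\nu$. Let $B=|Q|\,|\mathrm{Re}(\Lambda)^{-1}|$, $\chi^{(j)}=\sup_{|n|>N}|n|^j/|\mathrm{Re}\,\lambda_n|$ and $\beta^{(j)}=\big|(g^{(j)})'(\bar u)-\bar v^{(j)}_0\big|$ (the number $\bar v_0^{(j)}$ being subtracted from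 the zeroth coefficient). Let $\bar N\in\mathbb N$ be such that $\beta^{(j)}_n=0$ for all $|n|>\bar N$, $0\le j<2J$. Let $\Gamma$ be a matrix whose columns of index $|m|\le\bar N+N$ are entrywise upper bounds of the corresponding columns of $|Q^{-1}D\gamma(\bar u)|$, and such that $\Gamma a=\sum_{j<2J}|\mathcal D^j|(\beta^{(j)}*a)$ for $a$ supported in the modes $|m|>\bar N+N$. For $r_*>0$, and with $|p|(x)=\sum_k|p_k|x^k$ for a polynomial $p(x)=\sum_kp_kx^k$, define $$Y=\Big\|\,|Q|\,\big|Q^{-1}(u^{\mathrm{in}}+\mathcal L^{-1}\gamma(\bar u))\big|+\big|\bar u+\mathcal L^{-1}\gamma(\bar u)\big|\,\Big\|,\qquad Z=\max\Big(\|B\,\Gamma\,\Pi^{\le\bar N+N}\|,\ \sum_{j<2J}\|\beta^{(j)}\|\,\chi^{(j)}\Big),$$ $$W=\sum_{j<2J}\big\|B\,|Q^{-1}|\,|\mathcal D^j|\big\|\ \big|(g^{(j)})''\big|\big(\|\bar u\|+r_*\big).$$ **Theorem.** Assume that all the eigenvalues of $\mathcal L$ in $\ell^1_\nu$ have negative real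 part, and that for some $r\in(0,r_*)$ $$Y+Zr+\tfrac12Wr^2\le r\qquad\text{and}\qquad Z+Wr<1 .$$ Then there is a unique steady state $u^{\mathrm{stat}}$ in the closed ball of $\ell^1_\nu$ of center $\bar u$ and radius $r$, and there exists $\alpha<0$ such that the spectrum of $DF(u^{\mathrm{stat}})$ is contained in $\{z\in\mathbb C:\ \mathrm{Re}(z)<\alpha\}$. -/

import Mathlib

open scoped ENNReal NNReal Polynomial

noncomputable section

namespace Parabolic

/-! ### The sequence space `ℓ¹_ν` -/

/-- The subspace of all `a : ℤ → ℂ` with `∑ |a_n| ν^|n| < ∞`. -/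
def ell1Sub (ν : ℝ) : Submodule ℂ (ℤ → ℂ) where
  carrier := {a | Summable fun n : ℤ => ‖a n‖ * |ν| ^ n.natAbs}
  zero_mem' := by simp
  add_mem' := by
    intro a b ha hb
    refine Summable.of_nonneg_of_le (fun n => by positivity) (fun n => ?_) (ha.add hb)
    rw [← add_mul]
    exact mul_le_mul_of_nonneg_right (norm_add_le _ _) (by positivity)
  smul_mem' := by
    intro c a ha
    have h : (fun n : ℤ => ‖(c • a) n‖ * |ν| ^ n.natAbs)
        = fun n : ℤ => ‖c‖ * (‖a n‖ * |ν| ^ n.natAbs) := by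
      funext n
      simp [mul_assoc]
    simpa only [Set.mem_ofPred_eq, h] using Summable.mul_left ‖c‖ ha

/-- The Banach space `ℓ¹_ν` (for a weight `ν ≥ 1`) of sequences of Fourier coefficients. -/
def Ell1 (ν : ℝ) : Type := ell1Sub ν

section Ell1

variable {ν : ℝ}

instance : AddCommGroup (Ell1 ν) := inferInstanceAs (AddCommGroup (ell1Sub ν))

instance : Module ℂ (Ell1 ν) := inferInstanceAs (Module ℂ (ell1Sub ν))

/-- The sequence of coefficients of an element of `ℓ¹_ν`, as a linear map. -/
def coeffs : Ell1 ν →ₗ[ℂ] (ℤ → ℂ) := (ell1Sub ν).subtype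

instance : CoeFun (Ell1 ν) (fun _ => ℤ → ℂ) := ⟨fun a => coeffs a⟩

theorem Ell1.ext {a b : Ell1 ν} (h : ∀ n, a n = b n) : a = b :=
  Subtype.ext (funext h)

theorem Ell1.add_apply (a b : Ell1 ν) (n : ℤ) : (a + b) n = a n + b n := rfl

theorem Ell1.smul_apply (c : ℂ) (a : Ell1 ν) (n : ℤ) : (c • a) n = c * a n := rfl

variable [hν : Fact (1 ≤ ν)]

theorem Ell1.abs_weight : |ν| = ν := abs_of_nonneg (zero_le_one.trans hν.out)

theorem Ell1.summable (a : Ell1 ν) : Summable fun n : ℤ => ‖a n‖ * ν ^ n.natAbs := by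
  have h : Summable fun n : ℤ => ‖a n‖ * |ν| ^ n.natAbs := a.2
  rwa [Ell1.abs_weight] at h

/-- An element of `ℓ¹_ν` from its coefficients. -/
def Ell1.mk (a : ℤ → ℂ) (ha : Summable fun n : ℤ => ‖a n‖ * ν ^ n.natAbs) : Ell1 ν :=
  ⟨a, by rw [← Ell1.abs_weight (ν := ν)] at ha; exact ha⟩

theorem Ell1.weight_one_le (n : ℤ) : 1 ≤ ν ^ n.natAbs := one_le_pow₀ hν.out

/-- `‖a‖ = ∑ |a_n| ν^|n|`. -/
instance : NormedAddCommGroup (Ell1 ν) :=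
  AddGroupNorm.toNormedAddCommGroup
    { toFun := fun a => ∑' n : ℤ, ‖a n‖ * ν ^ n.natAbs
      map_zero' := by simp
      add_le' := by
        intro a b
        rw [← a.summable.tsum_add b.summable]
        refine Summable.tsum_le_tsum (fun n => ?_) (a + b).summable (a.summable.add b.summable)
        rw [← add_mul, Ell1.add_apply]
        exact mul_le_mul_of_nonneg_right (norm_add_le _ _)
          (zero_le_one.trans (Ell1.weight_one_le n))
      neg' := by intro a; simp
      eq_zero_of_map_eq_zero' := by
        intro a ha
        refine Ell1.ext fun n => ?_
        have hw : (0 : ℝ) < ν ^ n.natAbs := zero_lt_one.trans_le (Ell1.weight_one_le n)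
        have h0 : ∀ n : ℤ, 0 ≤ ‖a n‖ * ν ^ n.natAbs := fun n =>
          mul_nonneg (norm_nonneg _) (zero_le_one.trans (Ell1.weight_one_le n))
        have h1 : ‖a n‖ * ν ^ n.natAbs ≤ 0 :=
          (a.summable.le_tsum n fun m _ => h0 m).trans ha.le
        have h2 : ‖a n‖ ≤ 0 := by
          by_contra hc
          exact absurd h1 (not_le.2 (mul_pos (not_le.1 hc) hw))
        simpa using norm_le_zero_iff.1 h2 }

theorem Ell1.norm_def (a : Ell1 ν) : ‖a‖ = ∑' n : ℤ, ‖a n‖ * ν ^ n.natAbs := rfl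

instance : NormedSpace ℂ (Ell1 ν) where
  norm_smul_le c a := by
    rw [Ell1.norm_def, Ell1.norm_def, ← tsum_mul_left]
    refine le_of_eq (tsum_congr fun n => ?_)
    rw [Ell1.smul_apply, norm_mul, mul_assoc]

/-- The sequence `e_m`, i.e. the function `x ↦ exp(imx)`. -/
def Ell1.basis (m : ℤ) : Ell1 ν :=
  Ell1.mk (Pi.single m 1) <| by
    refine summable_of_ne_finset_zero (s := {m}) fun n hn => ?_
    rw [Pi.single_eq_of_ne (by simpa using hn)]
    simp

theorem Ell1.summable_conv_aux (a b : Ell1 ν) :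
    Summable fun p : ℤ × ℤ => ‖a p.1‖ * ‖b (p.2 - p.1)‖ * ν ^ p.2.natAbs := by
  have h1 : Summable fun p : ℤ × ℤ =>
      (‖a p.1‖ * ν ^ p.1.natAbs) * (‖b p.2‖ * ν ^ p.2.natAbs) :=
    a.summable.mul_of_nonneg b.summable
      (fun n => mul_nonneg (norm_nonneg _) (zero_le_one.trans (Ell1.weight_one_le n)))
      (fun n => mul_nonneg (norm_nonneg _) (zero_le_one.trans (Ell1.weight_one_le n)))
  let e : ℤ × ℤ ≃ ℤ × ℤ :=
    { toFun := fun p => (p.1, p.2 - p.1)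
      invFun := fun p => (p.1, p.1 + p.2)
      left_inv := fun p => by simp
      right_inv := fun p => by simp }
  refine Summable.of_nonneg_of_le
    (fun p => mul_nonneg (by positivity) (zero_le_one.trans (Ell1.weight_one_le _)))
    (fun p => ?_) (e.summable_iff.2 h1)
  have hp : p.2.natAbs ≤ p.1.natAbs + (p.2 - p.1).natAbs := by omega
  have hw : ν ^ p.2.natAbs ≤ ν ^ p.1.natAbs * ν ^ (p.2 - p.1).natAbs := by
    rw [← pow_add]
    exact pow_le_pow_right₀ hν.out hp
  calc ‖a p.1‖ * ‖b (p.2 - p.1)‖ * ν ^ p.2.natAbs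
      ≤ ‖a p.1‖ * ‖b (p.2 - p.1)‖ * (ν ^ p.1.natAbs * ν ^ (p.2 - p.1).natAbs) :=
        mul_le_mul_of_nonneg_left hw (by positivity)
    _ = (‖a p.1‖ * ν ^ p.1.natAbs) * (‖b (p.2 - p.1)‖ * ν ^ (p.2 - p.1).natAbs) := by ring

theorem Ell1.summable_conv (a b : Ell1 ν) (n : ℤ) : Summable fun m : ℤ => a m * b (n - m) := by
  refine Summable.of_norm ?_
  refine Summable.of_nonneg_of_le (fun m => norm_nonneg _) (fun m => ?_)
    ((Ell1.summable_conv_aux a b).prod_symm.prod_factor n)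
  rw [norm_mul]
  exact le_mul_of_one_le_right (by positivity) (Ell1.weight_one_le n)

/-- The discrete convolution `(a ∗ b)_n = ∑_m a_m b_{n-m}`. -/
def Ell1.conv (a b : Ell1 ν) : Ell1 ν :=
  Ell1.mk (fun n => ∑' m : ℤ, a m * b (n - m)) <| by
    have h := (Ell1.summable_conv_aux a b).prod_symm
    refine Summable.of_nonneg_of_le
      (fun n => mul_nonneg (norm_nonneg _) (zero_le_one.trans (Ell1.weight_one_le n)))
      (fun n => ?_) h.prod
    have hs := (Ell1.summable_conv a b n).norm
    calc ‖∑' m : ℤ, a m * b (n - m)‖ * ν ^ n.natAbs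
        ≤ (∑' m : ℤ, ‖a m * b (n - m)‖) * ν ^ n.natAbs :=
          mul_le_mul_of_nonneg_right (norm_tsum_le_tsum_norm hs)
            (zero_le_one.trans (Ell1.weight_one_le n))
      _ = ∑' m : ℤ, ‖a m‖ * ‖b (n - m)‖ * ν ^ n.natAbs := by
          rw [← tsum_mul_right]
          exact tsum_congr fun m => by rw [norm_mul]

theorem Ell1.conv_apply (a b : Ell1 ν) (n : ℤ) :
    Ell1.conv a b n = ∑' m : ℤ, a m * b (n - m) := rfl

/-- Convolution powers; `a^{∗0}` is the sequence of the constant function `1`. -/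
def Ell1.convPow (a : Ell1 ν) : ℕ → Ell1 ν
  | 0 => Ell1.basis 0
  | k + 1 => Ell1.conv a (Ell1.convPow a k)

/-- `p(a) = ∑ p_k a^{∗k}`, the Fourier coefficients of `x ↦ p(a(x))`. -/
def Ell1.poly (p : ℝ[X]) (a : Ell1 ν) : Ell1 ν :=
  ∑ k ∈ Finset.range (p.natDegree + 1), (p.coeff k : ℂ) • Ell1.convPow a k

end Ell1

/-! ### Spectrum of an unbounded operator -/

section Spectrum

variable {E : Type*} [NormedAddCommGroup E] [NormedSpace ℂ E]

/-- The resolvent set of an unbounded operator `A : D(A) ⊆ E → E`: all `z` such that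
`A - z : D(A) → E` is a bijection whose inverse is bounded on `E`. -/
def unboundedResolventSet (A : E →ₗ.[ℂ] E) : Set ℂ :=
  {z | ∃ R : E →L[ℂ] E,
    (∀ f : E, ∃ hf : R f ∈ A.domain, A ⟨R f, hf⟩ - z • R f = f) ∧
    ∀ h : A.domain, R (A h - z • (h : E)) = h}

/-- The spectrum of an unbounded operator, the complement of the resolvent set. -/
def unboundedSpectrum (A : E →ₗ.[ℂ] E) : Set ℂ := (unboundedResolventSet A)ᶜ

end Spectrum

/-! ### Matrices indexed by `ℤ` -/

/-- The action of an infinite matrix on a sequence (used for matrices with finite rows). -/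
def act (A : ℤ → ℤ → ℂ) (a : ℤ → ℂ) (n : ℤ) : ℂ := ∑' m : ℤ, A n m * a m

/-- The action of a matrix with nonnegative entries on a sequence with nonnegative entries. -/
def actE (A : ℤ → ℤ → ℝ≥0∞) (a : ℤ → ℝ≥0∞) (n : ℤ) : ℝ≥0∞ := ∑' m : ℤ, A n m * a m

/-- The product of two matrices with nonnegative entries. -/
def mulE (A B : ℤ → ℤ → ℝ≥0∞) (n m : ℤ) : ℝ≥0∞ := ∑' k : ℤ, A n k * B k m

/-- The `ℓ¹_ν`-norm, possibly `∞`, of a sequence with nonnegative entries. -/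
def normE (ν : ℝ) (a : ℤ → ℝ≥0∞) : ℝ≥0∞ := ∑' n : ℤ, a n * ENNReal.ofReal ν ^ n.natAbs

/-- The operator norm on `ℓ¹_ν`, possibly `∞`, of a matrix `A` with nonnegative entries.
As `|A a| ≤ A |a|` entrywise, only `|a|` for `a` in the unit ball needs to be considered. -/
def opNormE (ν : ℝ) [Fact (1 ≤ ν)] (A : ℤ → ℤ → ℝ≥0∞) : ℝ≥0∞ :=
  ⨆ (a : Ell1 ν) (_ : ‖a‖ ≤ 1), normE ν (actE A fun n => ‖a n‖ₑ)

/-- The modes `n` with `|n| ≤ N`. -/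
abbrev LowMode (N : ℕ) : Type := {n : ℤ // n ∈ Finset.Icc (-(N : ℤ)) N}

/-- Extension of a finite matrix on the modes `|n| ≤ N` by the identity on the other modes. -/
def blockExt {N : ℕ} (M : Matrix (LowMode N) (LowMode N) ℂ) (n m : ℤ) : ℂ :=
  if h : n ∈ Finset.Icc (-(N : ℤ)) N ∧ m ∈ Finset.Icc (-(N : ℤ)) N then
    M ⟨n, h.1⟩ ⟨m, h.2⟩
  else if n = m then 1 else 0

/-- The value at `x` of the polynomial `|p|` whose coefficients are the `|p_k|`. -/
def absPolyEval (p : ℝ[X]) (x : ℝ) : ℝ := ∑ k ∈ Finset.range (p.natDegree + 1), |p.coeff k| * x ^ k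

/-! ### The equation and the operator `𝓛` -/

/-- The equation `∂ₜ u = (-1)^(J+1) ∂ₓ^(2J) u + ∑_{j < 2J} ∂ₓ^j g^{(j)}(u)` on the torus (only the
polynomials `g j` with `j < 2J` matter), an approximate steady state `ubar`, and the data that
determine `𝓛`: a threshold `N`, an invertible matrix `Q` and numbers `lamLow n` for `|n| ≤ N`. -/
structure Setup (ν : ℝ) [Fact (1 ≤ ν)] where
  J : ℕ
  one_le_J : 1 ≤ J
  g : ℕ → ℝ[X]
  ubar : Ell1 ν
  N : ℕ
  Q : Matrix.GeneralLinearGroup (LowMode N) ℂ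
  lamLow : LowMode N → ℂ

namespace Setup

variable {ν : ℝ} [hν : Fact (1 ≤ ν)] (S : Setup ν)

/-- The spatial derivative `(𝓓^j a)_n = (in)^j a_n`, on arbitrary sequences. -/
def D (j : ℕ) (a : ℤ → ℂ) (n : ℤ) : ℂ := (Complex.I * (n : ℂ)) ^ j * a n

/-- The right-hand side `F(u)` of the equation, as a sequence of Fourier coefficients. -/
def F (u : Ell1 ν) (n : ℤ) : ℂ :=
  (-1) ^ (S.J + 1) * D (2 * S.J) u n
    + ∑ j ∈ Finset.range (2 * S.J), D j (Ell1.poly (S.g j) u) n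

/-- `u ∈ ℓ¹_ν` is a steady state if all Fourier coefficients of `F(u)` vanish. -/
def IsSteadyState (u : Ell1 ν) : Prop := ∀ n, S.F u n = 0

/-- The sequence `DF(u)h = (-1)^(J+1) 𝓓^(2J) h + ∑_{j < 2J} 𝓓^j ((g^{(j)})'(u) ∗ h)`; it need
not be in `ℓ¹_ν`. -/
def DF (u : Ell1 ν) : Ell1 ν →ₗ[ℂ] (ℤ → ℂ) where
  toFun h n := (-1) ^ (S.J + 1) * D (2 * S.J) h n
    + ∑ j ∈ Finset.range (2 * S.J),
        D j (Ell1.conv (Ell1.poly (Polynomial.derivative (S.g j)) u) h) n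
  map_add' h k := by
    funext n
    have hc : ∀ c : Ell1 ν, Ell1.conv c (h + k) n = Ell1.conv c h n + Ell1.conv c k n := by
      intro c
      simp only [Ell1.conv_apply, Ell1.add_apply, mul_add]
      exact (Ell1.summable_conv c h n).tsum_add (Ell1.summable_conv c k n)
    simp only [D, hc, Ell1.add_apply, mul_add, Finset.sum_add_distrib, Pi.add_apply]
    ring
  map_smul' s h := by
    funext n
    have hc : ∀ c : Ell1 ν, Ell1.conv c (s • h) n = s * Ell1.conv c h n := by
      intro c
      simp only [Ell1.conv_apply, Ell1.smul_apply, ← tsum_mul_left]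
      exact tsum_congr fun m => by ring
    simp only [D, hc, Ell1.smul_apply, Pi.smul_apply, smul_eq_mul, RingHom.id_apply, mul_add,
      Finset.mul_sum]
    congr 1
    · ring
    · exact Finset.sum_congr rfl fun j _ => by ring

/-- `DF(u)` as an unbounded operator in `ℓ¹_ν`, with domain `{h ∈ ℓ¹_ν | DF(u)h ∈ ℓ¹_ν}`. (If `u`
is a steady state, `u` is smooth and this is the set of all `h ∈ ℓ¹_ν` with
`𝓓^(2J) h ∈ ℓ¹_ν`.) -/
def linearization (u : Ell1 ν) : Ell1 ν →ₗ.[ℂ] Ell1 ν where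
  domain := (ell1Sub ν).comap (S.DF u)
  toFun := (S.DF u).restrict (p := (ell1Sub ν).comap (S.DF u)) (q := ell1Sub ν) fun _ hx => hx

/-- `v̄_0^{(j)}`, the zeroth Fourier coefficient of `(g^{(j)})'(ū)`. -/
def vbar (j : ℕ) : ℂ := Ell1.poly (Polynomial.derivative (S.g j)) S.ubar 0

/-- The diagonal `(λ_n)` of `Λ`: free for `|n| ≤ N`, and
`λ_n = -n^(2J) + ∑_{j < 2J} (in)^j v̄_0^{(j)}` for `|n| > N`. -/
def lam (n : ℤ) : ℂ :=
  if h : n ∈ Finset.Icc (-(S.N : ℤ)) S.N then S.lamLow ⟨n, h⟩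
  else -(n : ℂ) ^ (2 * S.J)
    + ∑ j ∈ Finset.range (2 * S.J), (Complex.I * (n : ℂ)) ^ j * S.vbar j

/-- `Q`, extended by the identity. -/
def Qmat : ℤ → ℤ → ℂ := blockExt (S.Q : Matrix (LowMode S.N) (LowMode S.N) ℂ)

/-- `Q⁻¹`, extended by the identity. -/
def Qinv : ℤ → ℤ → ℂ :=
  blockExt ((S.Q⁻¹ : Matrix.GeneralLinearGroup (LowMode S.N) ℂ) :
    Matrix (LowMode S.N) (LowMode S.N) ℂ)

/-- `𝓛 = Q Λ Q⁻¹`, on arbitrary sequences. -/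
def L (a : ℤ → ℂ) : ℤ → ℂ := act S.Qmat fun n => S.lam n * act S.Qinv a n

/-- `𝓛⁻¹ = Q Λ⁻¹ Q⁻¹`, on arbitrary sequences (meaningful if no `λ_n` is zero). -/
def Linv (a : ℤ → ℂ) : ℤ → ℂ := act S.Qmat fun n => (S.lam n)⁻¹ * act S.Qinv a n

/-- `μ` is an eigenvalue of `𝓛` as an operator in `ℓ¹_ν`. -/
def IsEigenvalueL (μ : ℂ) : Prop := ∃ h : Ell1 ν, h ≠ 0 ∧ ∀ n, S.L h n = μ * h n

/-- `γ(u) = F(u) - 𝓛u`. -/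
def gam (u : Ell1 ν) (n : ℤ) : ℂ := S.F u n - S.L u n

/-- `Dγ(u)h = DF(u)h - 𝓛h`. -/
def Dgam (u h : Ell1 ν) (n : ℤ) : ℂ := S.DF u h n - S.L h n

/-! ### The bounds `Y`, `Z` and `W` -/

/-- `|Q|`, the entrywise absolute value. -/
def absQ (n m : ℤ) : ℝ≥0∞ := ‖S.Qmat n m‖ₑ

/-- `|Q⁻¹|`, the entrywise absolute value. -/
def absQinv (n m : ℤ) : ℝ≥0∞ := ‖S.Qinv n m‖ₑ

/-- `B = |Q| |Re(Λ)⁻¹|`. -/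
def B (n m : ℤ) : ℝ≥0∞ := S.absQ n m / ‖(S.lam m).re‖ₑ

/-- `Y = ‖ |Q| |Q⁻¹ (uⁱⁿ + 𝓛⁻¹γ(ū))| + |ū + 𝓛⁻¹γ(ū)| ‖`. -/
def Y (uin : Ell1 ν) : ℝ≥0∞ :=
  normE ν fun n =>
    actE S.absQ (fun k => ‖act S.Qinv (fun m => uin m + S.Linv (S.gam S.ubar) m) k‖ₑ) n
      + ‖S.ubar n + S.Linv (S.gam S.ubar) n‖ₑ

/-- `β^{(j)} = |(g^{(j)})'(ū) - v̄_0^{(j)}|`, coefficientwise. -/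
def beta (j : ℕ) (n : ℤ) : ℝ≥0∞ :=
  ‖Ell1.poly (Polynomial.derivative (S.g j)) S.ubar n - (if n = 0 then S.vbar j else 0)‖ₑ

/-- `χ^{(j)} = sup_{|n| > N} |n|^j / |Re λ_n|`. -/
def chi (j : ℕ) : ℝ≥0∞ :=
  ⨆ (n : ℤ) (_ : S.N < n.natAbs), (n.natAbs : ℝ≥0∞) ^ j / ‖(S.lam n).re‖ₑ

/-- `Nbar` is such that all `β^{(j)}` vanish at the modes `|n| > Nbar`. -/
def IsBandwidth (Nbar : ℕ) : Prop :=
  ∀ j < 2 * S.J, ∀ n : ℤ, Nbar < n.natAbs → S.beta j n = 0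

/-- The columns `|m| ≤ Nbar + N` of `G` are entrywise upper bounds for those of
`|Q⁻¹ Dγ(ū)|`. The `m`-th column of `Q⁻¹ Dγ(ū)` is its value at `e_m`. -/
def IsLowBound (Nbar : ℕ) (G : ℤ → ℤ → ℝ≥0) : Prop :=
  ∀ n m : ℤ, m.natAbs ≤ Nbar + S.N →
    ‖act S.Qinv (S.Dgam S.ubar (Ell1.basis m)) n‖ₑ ≤ (G n m : ℝ≥0∞)

/-- The matrix `Γ`: the columns of `G` for `|m| ≤ Nbar + N`, and
`a ↦ ∑_{j < 2J} |𝓓^j| (β^{(j)} ∗ a)` on the modes `|m| > Nbar + N`. -/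
def Gam (Nbar : ℕ) (G : ℤ → ℤ → ℝ≥0) (n m : ℤ) : ℝ≥0∞ :=
  if m.natAbs ≤ Nbar + S.N then (G n m : ℝ≥0∞)
  else ∑ j ∈ Finset.range (2 * S.J), (n.natAbs : ℝ≥0∞) ^ j * S.beta j (n - m)

/-- `Z = max(‖B Γ Π^{≤ Nbar + N}‖, ∑_{j < 2J} ‖β^{(j)}‖ χ^{(j)})`. -/
def Z (Nbar : ℕ) (G : ℤ → ℤ → ℝ≥0) : ℝ≥0∞ :=
  max
    (opNormE ν fun n m => if m.natAbs ≤ Nbar + S.N then mulE S.B (S.Gam Nbar G) n m else 0)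
    (∑ j ∈ Finset.range (2 * S.J), normE ν (S.beta j) * S.chi j)

/-- `W = ∑_{j < 2J} ‖B |Q⁻¹| |𝓓^j|‖ · |(g^{(j)})''|(‖ū‖ + r_*)`. -/
def W (rs : ℝ) : ℝ≥0∞ :=
  ∑ j ∈ Finset.range (2 * S.J),
    opNormE ν (fun n m => mulE S.B S.absQinv n m * (m.natAbs : ℝ≥0∞) ^ j)
      * ENNReal.ofReal
          (absPolyEval (Polynomial.derivative (Polynomial.derivative (S.g j))) (‖S.ubar‖ + rs))

end Setup

end Parabolic

end

open scoped ENNReal NNReal Polynomial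

noncomputable section

namespace Parabolic

/-! ### The Banach algebra `ℓ¹_ν` under convolution. -/

section Ell1

/-! Write DF(u) - z = (𝓛 - z) + Dγ(u). As 𝓛 is conjugate to a diagonal operator, the eigenvalue
hypothesis together with the dominance of -n^(2J) at high modes gives a uniform gap Re λ_n ≤ -δ < 0
(`exists_le_neg_re_lam`). Right-hand sides are measured by `resNorm`, in which |Re λ_n| stands in
for the modulus of the eigenvalue. This one quantity bounds 𝓛⁻¹a in ℓ¹_ν and, up to a factor κ⁻¹,
also (𝓛 - z)⁻¹a for all z with Re z ≥ -(1-κ)δ at once (`normE_conjDiag_le`, `enorm_inv_lam_sub_le`).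

A single pair of constants therefore serves twice. On the ball, Dγ(u) is bounded from the ℓ¹_ν norm
to `resNorm` by Z + Wr (`resNorm_Dgam_le`), and `resNorm_gam_sub_gam_le` is the analogue for
differences of γ. For z = 0, steady states are the fixed points of u ↦ -𝓛⁻¹γ(u), and this map is a
contraction of the ball. For general z, DF(u) - z = (𝓛 - z)(1 + (𝓛 - z)⁻¹Dγ(u)), where the
perturbation has norm at most (Z + Wr)/κ. Choosing κ strictly between Z + Wr and 1, a Neumann series
inverts the second factor for every z with Re z ≥ -(1-κ)δ, which leaves the spectrum to the left of
that line.

Since F, 𝓛 and Dγ(u) lose derivatives, they act on arbitrary sequences ℤ → ℂ; membership in ℓ¹_ν is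
recovered only after (𝓛 - z)⁻¹ has been applied. -/

theorem Ell1.sub_apply {ν : ℝ} (a b : Ell1 ν) (n : ℤ) : (a - b) n = a n - b n := rfl

variable {ν : ℝ} [hν : Fact (1 ≤ ν)]

theorem Ell1.weight_pos (n : ℤ) : 0 < ν ^ n.natAbs :=
  zero_lt_one.trans_le (Ell1.weight_one_le n)

theorem Ell1.ofReal_weight (n : ℤ) : ENNReal.ofReal (ν ^ n.natAbs) = ENNReal.ofReal ν ^ n.natAbs :=
  ENNReal.ofReal_pow (zero_le_one.trans hν.out) _

theorem Ell1.ofReal_norm_mul_weight (x : ℂ) (n : ℤ) :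
    ENNReal.ofReal (‖x‖ * ν ^ n.natAbs) = ‖x‖ₑ * ENNReal.ofReal ν ^ n.natAbs := by
  rw [ENNReal.ofReal_mul (norm_nonneg _), ofReal_norm, Ell1.ofReal_weight]

theorem Ell1.enorm_eq_normE (a : Ell1 ν) : ‖a‖ₑ = normE ν fun n => ‖a n‖ₑ := by
  rw [← ofReal_norm, Ell1.norm_def, ENNReal.ofReal_tsum_of_nonneg _ a.summable]
  · exact tsum_congr fun n => Ell1.ofReal_norm_mul_weight _ n
  · exact fun n => mul_nonneg (norm_nonneg _) (Ell1.weight_pos n).le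

theorem Ell1.mk_apply (a : ℤ → ℂ) (ha : Summable fun n : ℤ => ‖a n‖ * ν ^ n.natAbs) (n : ℤ) :
    Ell1.mk a ha n = a n := rfl

theorem Ell1.summable_of_normE_ne_top {a : ℤ → ℂ} (ha : normE ν (fun n => ‖a n‖ₑ) ≠ ∞) :
    Summable fun n : ℤ => ‖a n‖ * ν ^ n.natAbs := by
  have h : normE ν (fun n => ‖a n‖ₑ) = ∑' n : ℤ, ENNReal.ofReal (‖a n‖ * ν ^ n.natAbs) :=
    tsum_congr fun n => (Ell1.ofReal_norm_mul_weight _ n).symm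
  rw [h] at ha
  refine (ENNReal.summable_toReal ha).congr fun n => ?_
  exact ENNReal.toReal_ofReal (mul_nonneg (norm_nonneg _) (Ell1.weight_pos n).le)

/-- The element of `ℓ¹_ν` with given coefficients, and `0` if there is none. -/
def Ell1.ofSeq (ν : ℝ) [Fact (1 ≤ ν)] (a : ℤ → ℂ) : Ell1 ν :=
  open Classical in
  if ha : Summable fun n : ℤ => ‖a n‖ * ν ^ n.natAbs then Ell1.mk a ha else 0

theorem Ell1.ofSeq_apply {a : ℤ → ℂ} (ha : normE ν (fun n => ‖a n‖ₑ) ≠ ∞) (n : ℤ) :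
    Ell1.ofSeq ν a n = a n := by
  rw [Ell1.ofSeq, dif_pos (Ell1.summable_of_normE_ne_top ha), Ell1.mk_apply]

theorem Ell1.norm_apply_mul_le (a : Ell1 ν) (n : ℤ) : ‖a n‖ * ν ^ n.natAbs ≤ ‖a‖ :=
  a.summable.le_tsum n fun m _ => mul_nonneg (norm_nonneg _) (Ell1.weight_pos m).le

theorem Ell1.norm_apply_le (a : Ell1 ν) (n : ℤ) : ‖a n‖ ≤ ‖a‖ :=
  (le_mul_of_one_le_right (norm_nonneg _) (Ell1.weight_one_le n)).trans (a.norm_apply_mul_le n)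

/-- The coefficient of index `n` as a continuous linear functional. -/
def Ell1.coeffL (n : ℤ) : Ell1 ν →L[ℂ] ℂ :=
  LinearMap.mkContinuous ((LinearMap.proj n).comp coeffs) 1 fun a => by
    simpa using Ell1.norm_apply_le a n

theorem Ell1.coeffL_apply (n : ℤ) (a : Ell1 ν) : Ell1.coeffL n a = a n := rfl

theorem Ell1.basis_apply (m n : ℤ) : (Ell1.basis m : Ell1 ν) n = if n = m then 1 else 0 := by
  rw [Ell1.basis, Ell1.mk_apply, Pi.single_apply]

theorem Ell1.norm_basis (m : ℤ) : ‖(Ell1.basis m : Ell1 ν)‖ = ν ^ m.natAbs := by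
  rw [Ell1.norm_def, tsum_eq_single m]
  · simp [Ell1.basis_apply]
  · intro n hn
    simp [Ell1.basis_apply, hn]

/-- `ℓ¹_ν` is isometric to the unweighted `ℓ¹`. -/
def Ell1.isometryLp : Ell1 ν ≃ᵢ lp (fun _ : ℤ => ℂ) 1 :=
  IsometryEquiv.mk'
    (fun a => ⟨fun n => (ν ^ n.natAbs : ℝ) • a n, by
      refine memℓp_gen ?_
      refine a.summable.congr fun n => ?_
      simp [mul_comm, abs_of_pos (zero_lt_one.trans_le hν.out)]⟩)
    (fun b => Ell1.mk (fun n => (ν ^ n.natAbs : ℝ)⁻¹ • b n) (by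
      have hb := (memℓp_gen_iff (p := 1) (by simp)).1 b.2
      refine hb.congr fun n => ?_
      have := (Ell1.weight_pos (ν := ν) n).ne'
      simp only [norm_smul, norm_inv, Real.norm_eq_abs, abs_of_pos (Ell1.weight_pos (ν := ν) n),
        ENNReal.toReal_one, Real.rpow_one]
      field_simp))
    (fun b => by
      ext n
      have := (Ell1.weight_pos (ν := ν) n).ne'
      change (ν ^ n.natAbs : ℝ) • ((ν ^ n.natAbs : ℝ)⁻¹ • b n) = b n
      exact smul_inv_smul₀ this _)
    (by
      refine Isometry.of_dist_eq fun a b => ?_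
      rw [dist_eq_norm, dist_eq_norm, lp.norm_eq_tsum_rpow (by simp), Ell1.norm_def]
      simp only [ENNReal.toReal_one, Real.rpow_one, div_one]
      refine tsum_congr fun n => ?_
      rw [lp.coeFn_sub, Pi.sub_apply, ← smul_sub, norm_smul, mul_comm, Real.norm_eq_abs,
        abs_of_pos (Ell1.weight_pos (ν := ν) n), Ell1.sub_apply])

instance : CompleteSpace (Ell1 ν) := Ell1.isometryLp.completeSpace

theorem Ell1.hasSum_basis (a : Ell1 ν) : HasSum (fun m : ℤ => a m • Ell1.basis m) a := by
  have hs : Summable fun m : ℤ => a m • (Ell1.basis m : Ell1 ν) := by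
    refine Summable.of_norm (a.summable.congr fun m => ?_)
    rw [norm_smul, Ell1.norm_basis]
  convert hs.hasSum
  refine Ell1.ext fun n => ?_
  -- Convergence in ℓ¹_ν implies coefficientwise convergence, which identifies the sum.
  have h := (Ell1.coeffL (ν := ν) n).hasSum hs.hasSum
  refine HasSum.unique (f := fun m : ℤ => Ell1.coeffL n (a m • (Ell1.basis m : Ell1 ν))) ?_ h
  simp only [Ell1.coeffL_apply, Ell1.smul_apply, Ell1.basis_apply]
  convert hasSum_ite_eq n (a n) using 2 with m
  by_cases h : n = m
  · simp [h]
  · simp [h, Ne.symm h]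

/-- The e_m have dense span. Algebraic identities for convolution thus reduce to addition of
indices. -/
theorem Ell1.clm_ext {F : Type*} [NormedAddCommGroup F] [NormedSpace ℂ F] {f g : Ell1 ν →L[ℂ] F}
    (h : ∀ m, f (Ell1.basis m) = g (Ell1.basis m)) : f = g := by
  ext a
  refine (f.hasSum a.hasSum_basis).unique ?_
  convert g.hasSum a.hasSum_basis using 2 with m
  simp only [map_smul, h]

theorem Ell1.one_le_ofReal : 1 ≤ ENNReal.ofReal ν := ENNReal.one_le_ofReal.2 hν.out

/-- Submultiplicativity of the weight: |n + m| ≤ |n| + |m| and ν ≥ 1. -/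
theorem normE_shift_le (b : ℤ → ℝ≥0∞) (m : ℤ) :
    normE ν (fun n => b (n - m)) ≤ normE ν b * ENNReal.ofReal ν ^ m.natAbs := by
  rw [normE, normE, ← (Equiv.addRight m).tsum_eq, ← ENNReal.tsum_mul_right]
  refine ENNReal.tsum_le_tsum fun n => ?_
  rw [Equiv.coe_addRight, add_sub_cancel_right, mul_assoc, ← pow_add]
  gcongr
  · exact Ell1.one_le_ofReal
  · change (n + m).natAbs ≤ _
    omega

theorem Ell1.norm_conv_le (a b : Ell1 ν) : ‖Ell1.conv a b‖ ≤ ‖a‖ * ‖b‖ := by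
  suffices h : ‖Ell1.conv a b‖ₑ ≤ ‖a‖ₑ * ‖b‖ₑ by
    rw [← ofReal_norm, ← ofReal_norm, ← ofReal_norm,
      ← ENNReal.ofReal_mul (norm_nonneg _)] at h
    exact (ENNReal.ofReal_le_ofReal_iff (by positivity)).1 h
  rw [Ell1.enorm_eq_normE, Ell1.enorm_eq_normE, Ell1.enorm_eq_normE]
  calc normE ν (fun n => ‖Ell1.conv a b n‖ₑ)
      ≤ ∑' n : ℤ, (∑' m : ℤ, ‖a m‖ₑ * ‖b (n - m)‖ₑ) * ENNReal.ofReal ν ^ n.natAbs := by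
        refine ENNReal.tsum_le_tsum fun n => mul_le_mul_left (α := ℝ≥0∞) ?_ _
        simp only [Ell1.conv_apply, ← enorm_mul]
        exact enorm_tsum_le_tsum_enorm
    _ = ∑' m : ℤ, ‖a m‖ₑ * normE ν (fun n => ‖b (n - m)‖ₑ) := by
        simp only [← ENNReal.tsum_mul_right]
        rw [ENNReal.tsum_comm]
        refine tsum_congr fun m => ?_
        rw [normE, ← ENNReal.tsum_mul_left]
        exact tsum_congr fun n => mul_assoc _ _ _
    _ ≤ ∑' m : ℤ, (‖a m‖ₑ * ENNReal.ofReal ν ^ m.natAbs) * normE ν (fun n => ‖b n‖ₑ) := by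
        refine ENNReal.tsum_le_tsum fun m => ?_
        rw [mul_right_comm, mul_assoc]
        exact mul_le_mul_right (normE_shift_le (fun n => ‖b n‖ₑ) m) _
    _ = _ := by rw [ENNReal.tsum_mul_right]; rfl

/-- Convolution as a continuous bilinear map. -/
def Ell1.convL : Ell1 ν →L[ℂ] Ell1 ν →L[ℂ] Ell1 ν :=
  LinearMap.mkContinuous₂
    (LinearMap.mk₂ ℂ Ell1.conv
      (fun a b c => Ell1.ext fun n => by
        simp only [Ell1.conv_apply, Ell1.add_apply, add_mul]
        exact (Ell1.summable_conv a c n).tsum_add (Ell1.summable_conv b c n))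
      (fun s a b => Ell1.ext fun n => by
        simp only [Ell1.conv_apply, Ell1.smul_apply, ← tsum_mul_left]
        exact tsum_congr fun m => by ring)
      (fun a b c => Ell1.ext fun n => by
        simp only [Ell1.conv_apply, Ell1.add_apply, mul_add]
        exact (Ell1.summable_conv a b n).tsum_add (Ell1.summable_conv a c n))
      (fun s a b => Ell1.ext fun n => by
        simp only [Ell1.conv_apply, Ell1.smul_apply, ← tsum_mul_left]
        exact tsum_congr fun m => by ring))
    1 fun a b => by simpa using Ell1.norm_conv_le a b

theorem Ell1.convL_apply (a b : Ell1 ν) : Ell1.convL a b = Ell1.conv a b := rfl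

theorem Ell1.conv_basis_apply (a : Ell1 ν) (m n : ℤ) :
    Ell1.conv a (Ell1.basis m) n = a (n - m) := by
  rw [Ell1.conv_apply, tsum_eq_single (n - m)]
  · simp [Ell1.basis_apply]
  · intro k hk
    rw [Ell1.basis_apply, if_neg (by omega), mul_zero]

theorem Ell1.basis_conv_basis (k m : ℤ) :
    Ell1.conv (Ell1.basis k) (Ell1.basis m : Ell1 ν) = Ell1.basis (k + m) := by
  refine Ell1.ext fun n => ?_
  rw [Ell1.conv_basis_apply, Ell1.basis_apply, Ell1.basis_apply]
  exact if_congr (by omega) rfl rfl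

theorem Ell1.conv_comm (a b : Ell1 ν) : Ell1.conv a b = Ell1.conv b a := by
  have h : Ell1.convL = (Ell1.convL (ν := ν)).flip := by
    refine Ell1.clm_ext fun k => Ell1.clm_ext fun m => ?_
    rw [ContinuousLinearMap.flip_apply, Ell1.convL_apply, Ell1.convL_apply,
      Ell1.basis_conv_basis, Ell1.basis_conv_basis, add_comm]
  exact congrArg (fun f => f a b) h

theorem Ell1.conv_assoc (a b c : Ell1 ν) :
    Ell1.conv (Ell1.conv a b) c = Ell1.conv a (Ell1.conv b c) := by
  -- Both sides are continuous and linear in each variable separately, so a, then b, then c may be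
  -- taken to be a basis vector.
  have h1 : ∀ (b c : Ell1 ν), (Ell1.convL.flip c).comp (Ell1.convL.flip b)
      = Ell1.convL.flip (Ell1.conv b c) := by
    intro b c
    refine Ell1.clm_ext fun k => ?_
    have h2 : ∀ c : Ell1 ν, (Ell1.convL.flip c).comp (Ell1.convL (Ell1.basis k))
        = (Ell1.convL (Ell1.basis k)).comp (Ell1.convL.flip c) := by
      intro c
      refine Ell1.clm_ext fun l => ?_
      have h3 : Ell1.convL (Ell1.conv (Ell1.basis k) (Ell1.basis l : Ell1 ν))
          = (Ell1.convL (Ell1.basis k)).comp (Ell1.convL (Ell1.basis l)) := by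
        refine Ell1.clm_ext fun m => ?_
        simp only [ContinuousLinearMap.comp_apply, Ell1.convL_apply, Ell1.basis_conv_basis,
          add_assoc]
      exact congrArg (fun f => f c) h3
    exact congrArg (fun f => f b) (h2 c)
  exact congrArg (fun f => f a) (h1 b c)

theorem Ell1.basis_zero_conv (a : Ell1 ν) : Ell1.conv (Ell1.basis 0) a = a := by
  rw [Ell1.conv_comm]
  exact Ell1.ext fun n => by rw [Ell1.conv_basis_apply, sub_zero]

/-- `ℓ¹_ν` with the convolution product. -/
scoped instance : CommRing (Ell1 ν) :=
  { (inferInstance : AddCommGroup (Ell1 ν)) with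
    mul := Ell1.conv
    one := Ell1.basis 0
    mul_assoc := Ell1.conv_assoc
    mul_comm := Ell1.conv_comm
    one_mul := Ell1.basis_zero_conv
    mul_one := fun a => (Ell1.conv_comm a _).trans (Ell1.basis_zero_conv a)
    left_distrib := fun a b c => (Ell1.convL a).map_add b c
    right_distrib := fun a b c => Ell1.convL.map_add₂ a b c
    zero_mul := fun a => Ell1.convL.map_zero₂ a
    mul_zero := fun a => (Ell1.convL a).map_zero }

scoped instance : NormedCommRing (Ell1 ν) :=
  { (inferInstance : NormedAddCommGroup (Ell1 ν)), (inferInstance : CommRing (Ell1 ν)) with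
    norm_mul_le := Ell1.norm_conv_le }

scoped instance : NormedAlgebra ℂ (Ell1 ν) :=
  { Algebra.ofModule (fun s a b => Ell1.convL.map_smul₂ s a b)
      (fun s a b => (Ell1.convL a).map_smul s b) with
    norm_smul_le := norm_smul_le }

theorem Ell1.mul_def (a b : Ell1 ν) : a * b = Ell1.conv a b := rfl

theorem Ell1.convPow_eq_pow (a : Ell1 ν) (k : ℕ) : Ell1.convPow a k = a ^ k := by
  induction k with
  | zero => rw [pow_zero]; rfl
  | succ k ih => rw [pow_succ', ← ih]; rfl

theorem Ell1.norm_one : ‖(1 : Ell1 ν)‖ = 1 :=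
  (Ell1.norm_basis 0).trans (pow_zero ν)

scoped instance : NormOneClass (Ell1 ν) := ⟨Ell1.norm_one⟩

end Ell1

/-! ### Taylor estimates for powers in a normed commutative ring. -/

section Poly

variable {A : Type*} [NormedCommRing A] [NormOneClass A]

theorem norm_natCast_mul_pow_mul_mul_le [NormedAlgebra ℝ A] (k j : ℕ) {c x y : A} {s : ℝ}
    (hc : ‖c‖ ≤ s) : ‖(k : A) * c ^ j * x * y‖ ≤ k * s ^ j * ‖x‖ * ‖y‖ := by
  have hk : ‖(k : A)‖ = k := by
    simpa using norm_algebraMap' A (k : ℝ)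
  have hp : ‖c ^ j‖ ≤ s ^ j := (norm_pow_le c j).trans (by gcongr)
  calc ‖(k : A) * c ^ j * x * y‖ ≤ ‖(k : A)‖ * ‖c ^ j‖ * ‖x‖ * ‖y‖ := by
        refine (norm_mul_le _ _).trans ?_
        gcongr
        refine (norm_mul_le _ _).trans ?_
        gcongr
        exact norm_mul_le _ _
    _ ≤ _ := by rw [hk]; gcongr

theorem norm_pow_sub_pow_le {u w : A} {s : ℝ} (hu : ‖u‖ ≤ s) (hw : ‖w‖ ≤ s) (k : ℕ) :
    ‖u ^ k - w ^ k‖ ≤ k * s ^ (k - 1) * ‖u - w‖ := by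
  have hs : 0 ≤ s := (norm_nonneg u).trans hu
  induction k with
  | zero => simp
  | succ k ih =>
    have h1 : u ^ (k + 1) - w ^ (k + 1) = u * (u ^ k - w ^ k) + w ^ k * (u - w) := by ring
    have h2 : ‖w ^ k‖ ≤ s ^ k := (norm_pow_le w k).trans (by gcongr)
    have h3 : s * (k * s ^ (k - 1)) = k * s ^ k := by
      cases k with
      | zero => simp
      | succ k => rw [Nat.add_sub_cancel]; ring
    calc ‖u ^ (k + 1) - w ^ (k + 1)‖ ≤ ‖u‖ * ‖u ^ k - w ^ k‖ + ‖w ^ k‖ * ‖u - w‖ := by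
          rw [h1]
          exact (norm_add_le _ _).trans (add_le_add (norm_mul_le _ _) (norm_mul_le _ _))
      _ ≤ s * (k * s ^ (k - 1) * ‖u - w‖) + s ^ k * ‖u - w‖ := by gcongr
      _ = (s * (k * s ^ (k - 1)) + s ^ k) * ‖u - w‖ := by ring
      _ = _ := by rw [h3, Nat.add_sub_cancel]; push_cast; ring

/-- The difference is linearized at a third point c, so one estimate gives both the self-map bound
(w = c, whence the factor ½) and the contraction bound (u and w arbitrary in a ball around c). -/
theorem norm_pow_sub_pow_sub_le [NormedAlgebra ℝ A] {c u w : A} {s : ℝ} (hc : ‖c‖ ≤ s)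
    (hu : ‖u‖ ≤ s) (hw : ‖w‖ ≤ s) (k : ℕ) :
    ‖u ^ k - w ^ k - (k : A) * c ^ (k - 1) * (u - w)‖
      ≤ k * (k - 1 : ℕ) * s ^ (k - 2) * ((‖u - c‖ + ‖w - c‖) / 2) * ‖u - w‖ := by
  have hs : 0 ≤ s := (norm_nonneg u).trans hu
  induction k with
  | zero => simp
  | succ k ih =>
    -- The last two terms correct for multiplying the linear part by u instead of c, and for using
    -- w^k instead of c^k. Each contributes one of the two distances in the half-sum.
    have h1 : u ^ (k + 1) - w ^ (k + 1) - ((k + 1 : ℕ) : A) * c ^ (k + 1 - 1) * (u - w)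
        = u * (u ^ k - w ^ k - (k : A) * c ^ (k - 1) * (u - w))
          + (k : A) * c ^ (k - 1) * (u - c) * (u - w) + (w ^ k - c ^ k) * (u - w) := by
      cases k with
      | zero => simp
      | succ k => rw [Nat.add_sub_cancel, Nat.add_sub_cancel]; push_cast; ring
    have h3 : s * (k * (k - 1 : ℕ) * s ^ (k - 2)) = k * (k - 1 : ℕ) * s ^ (k - 1) := by
      rcases k with _ | _ | k
      · simp
      · simp
      · rw [show k + 1 + 1 - 1 = k + 1 by omega, show k + 1 + 1 - 2 = k by omega]; ring
    have h4 : ((k + 1 : ℕ) : ℝ) * (k + 1 - 1 : ℕ) = k * (k - 1 : ℕ) + 2 * k := by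
      rcases k with _ | k
      · simp
      · push_cast [Nat.add_sub_cancel]; ring
    calc _ ≤ ‖u‖ * ‖u ^ k - w ^ k - (k : A) * c ^ (k - 1) * (u - w)‖
            + ‖(k : A) * c ^ (k - 1) * (u - c) * (u - w)‖ + ‖w ^ k - c ^ k‖ * ‖u - w‖ := by
          rw [h1]
          exact norm_add₃_le.trans
            (add_le_add (add_le_add (norm_mul_le _ _) le_rfl) (norm_mul_le _ _))
      _ ≤ s * (k * (k - 1 : ℕ) * s ^ (k - 2) * ((‖u - c‖ + ‖w - c‖) / 2) * ‖u - w‖)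
            + k * s ^ (k - 1) * ‖u - c‖ * ‖u - w‖ + k * s ^ (k - 1) * ‖w - c‖ * ‖u - w‖ := by
          gcongr
          · exact norm_natCast_mul_pow_mul_mul_le k (k - 1) hc
          · exact norm_pow_sub_pow_le hw hc k
      _ = (s * (k * (k - 1 : ℕ) * s ^ (k - 2)) + 2 * k * s ^ (k - 1))
            * ((‖u - c‖ + ‖w - c‖) / 2) * ‖u - w‖ := by ring
      _ = _ := by
          rw [h3, h4, show k + 1 - 2 = k - 1 by omega]; ring

end Poly

/-! ### Coefficient formulas for derivatives of polynomials. -/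

theorem absPolyEval_eq_sum_range {p : ℝ[X]} {M : ℕ} (hM : p.natDegree < M) (x : ℝ) :
    absPolyEval p x = ∑ k ∈ Finset.range M, |p.coeff k| * x ^ k := by
  refine Finset.sum_subset (Finset.range_subset_range.2 hM) fun k _ hk => ?_
  rw [Polynomial.coeff_eq_zero_of_natDegree_lt (by simpa using hk)]
  simp

/-- Lets p, p' and p'' be summed over one common range, indexed by the coefficients of p, so that
the power estimates apply term by term. -/
theorem sum_range_shift {X : Type*} [AddCommMonoid X] {f : ℕ → X} {M : ℕ} (h0 : f 0 = 0)
    (hM : f M = 0) : ∑ k ∈ Finset.range M, f (k + 1) = ∑ k ∈ Finset.range M, f k := by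
  rw [← add_zero (∑ k ∈ Finset.range M, f (k + 1)), ← h0, ← Finset.sum_range_succ',
    Finset.sum_range_succ, hM, add_zero]

theorem natDegree_derivative_lt_of_lt {p : ℝ[X]} {M : ℕ} (hM : p.natDegree < M) :
    (Polynomial.derivative p).natDegree < M :=
  (Polynomial.natDegree_derivative_le p).trans_lt (by omega)

theorem absPolyEval_derivative {p : ℝ[X]} {M : ℕ} (hM : p.natDegree < M) (x : ℝ) :
    absPolyEval (Polynomial.derivative p) x
      = ∑ k ∈ Finset.range M, |p.coeff k| * (k * x ^ (k - 1)) := by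
  rw [absPolyEval_eq_sum_range (natDegree_derivative_lt_of_lt hM)]
  refine Eq.trans (Finset.sum_congr rfl fun k _ => ?_) (sum_range_shift ?_ ?_)
  · rw [Polynomial.coeff_derivative, abs_mul, ← Nat.cast_succ, Nat.abs_cast, Nat.add_sub_cancel]
    ring
  · simp
  · rw [Polynomial.coeff_eq_zero_of_natDegree_lt hM]
    simp

theorem absPolyEval_derivative_derivative {p : ℝ[X]} {M : ℕ} (hM : p.natDegree < M) (x : ℝ) :
    absPolyEval (Polynomial.derivative (Polynomial.derivative p)) x
      = ∑ k ∈ Finset.range M, |p.coeff k| * (k * (k - 1 : ℕ) * x ^ (k - 2)) := by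
  rw [absPolyEval_derivative (natDegree_derivative_lt_of_lt hM)]
  refine Eq.trans (Finset.sum_congr rfl fun k _ => ?_) (sum_range_shift ?_ ?_)
  · rw [Polynomial.coeff_derivative, abs_mul, ← Nat.cast_succ, Nat.abs_cast, Nat.add_sub_cancel,
      show k + 1 - 2 = k - 1 by omega]
    ring
  · simp
  · rw [Polynomial.coeff_eq_zero_of_natDegree_lt hM]
    simp

/-! ### Taylor estimates for polynomials of sequences. -/

section Ell1

variable {ν : ℝ} [hν : Fact (1 ≤ ν)]

theorem Ell1.poly_eq_sum_range {p : ℝ[X]} {M : ℕ} (hM : p.natDegree < M) (a : Ell1 ν) :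
    Ell1.poly p a = ∑ k ∈ Finset.range M, (p.coeff k : ℂ) • a ^ k := by
  simp only [Ell1.poly, Ell1.convPow_eq_pow]
  refine Finset.sum_subset (Finset.range_subset_range.2 hM) fun k _ hk => ?_
  rw [Polynomial.coeff_eq_zero_of_natDegree_lt (by simpa using hk)]
  simp

theorem Ell1.poly_derivative {p : ℝ[X]} {M : ℕ} (hM : p.natDegree < M) (a : Ell1 ν) :
    Ell1.poly (Polynomial.derivative p) a
      = ∑ k ∈ Finset.range M, (p.coeff k : ℂ) • ((k : Ell1 ν) * a ^ (k - 1)) := by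
  rw [Ell1.poly_eq_sum_range (natDegree_derivative_lt_of_lt hM)]
  refine Eq.trans (Finset.sum_congr rfl fun k _ => ?_) (sum_range_shift ?_ ?_)
  · rw [Polynomial.coeff_derivative, ← Nat.cast_succ, Nat.add_sub_cancel, ← nsmul_eq_mul,
      ← Nat.cast_smul_eq_nsmul ℂ, smul_smul]
    push_cast
    rfl
  · simp
  · rw [Polynomial.coeff_eq_zero_of_natDegree_lt hM]
    simp

theorem Ell1.norm_poly_sub_poly_le (p : ℝ[X]) {u w : Ell1 ν} {s : ℝ} (hu : ‖u‖ ≤ s)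
    (hw : ‖w‖ ≤ s) :
    ‖Ell1.poly p u - Ell1.poly p w‖ ≤ absPolyEval (Polynomial.derivative p) s * ‖u - w‖ := by
  rw [Ell1.poly_eq_sum_range (Nat.lt_succ_self _), Ell1.poly_eq_sum_range (Nat.lt_succ_self _),
    absPolyEval_derivative (Nat.lt_succ_self _), ← Finset.sum_sub_distrib, Finset.sum_mul]
  refine norm_sum_le_of_le _ fun k _ => ?_
  rw [← smul_sub, norm_smul, Complex.norm_real, Real.norm_eq_abs, mul_assoc]
  exact mul_le_mul_of_nonneg_left (norm_pow_sub_pow_le hu hw k) (abs_nonneg _)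

theorem Ell1.norm_poly_sub_poly_sub_le (p : ℝ[X]) {c u w : Ell1 ν} {s : ℝ} (hc : ‖c‖ ≤ s)
    (hu : ‖u‖ ≤ s) (hw : ‖w‖ ≤ s) :
    ‖Ell1.poly p u - Ell1.poly p w - Ell1.poly (Polynomial.derivative p) c * (u - w)‖
      ≤ absPolyEval (Polynomial.derivative (Polynomial.derivative p)) s
        * ((‖u - c‖ + ‖w - c‖) / 2) * ‖u - w‖ := by
  -- The power estimate needs ‖(k : A)‖ = k, which comes from a real algebra structure.
  let _ : NormedAlgebra ℝ (Ell1 ν) := NormedAlgebra.restrictScalars ℝ ℂ (Ell1 ν)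
  rw [Ell1.poly_eq_sum_range (Nat.lt_succ_self _), Ell1.poly_eq_sum_range (Nat.lt_succ_self _),
    Ell1.poly_derivative (Nat.lt_succ_self _),
    absPolyEval_derivative_derivative (Nat.lt_succ_self _), ← Finset.sum_sub_distrib,
    Finset.sum_mul, ← Finset.sum_sub_distrib, Finset.sum_mul, Finset.sum_mul]
  refine norm_sum_le_of_le _ fun k _ => ?_
  rw [smul_mul_assoc, ← smul_sub, ← smul_sub, norm_smul, Complex.norm_real, Real.norm_eq_abs,
    mul_assoc |_|, mul_assoc |_|]
  exact mul_le_mul_of_nonneg_left (norm_pow_sub_pow_sub_le hc hu hw k) (abs_nonneg _)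

end Ell1

/-! ### Block matrices -/

section BlockExt

variable {N : ℕ}

theorem lowMode_iff {n : ℤ} : n ∈ Finset.Icc (-(N : ℤ)) N ↔ n.natAbs ≤ N := by
  rw [Finset.mem_Icc]
  omega

theorem blockExt_low (M : Matrix (LowMode N) (LowMode N) ℂ) (n m : LowMode N) :
    blockExt M n m = M n m := dif_pos ⟨n.2, m.2⟩

theorem blockExt_of_row_notMem (M : Matrix (LowMode N) (LowMode N) ℂ) {n : ℤ}
    (hn : n ∉ Finset.Icc (-(N : ℤ)) N) (m : ℤ) : blockExt M n m = if n = m then 1 else 0 :=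
  dif_neg fun h => hn h.1

theorem blockExt_of_col_notMem (M : Matrix (LowMode N) (LowMode N) ℂ) (n : ℤ) {m : ℤ}
    (hm : m ∉ Finset.Icc (-(N : ℤ)) N) : blockExt M n m = if n = m then 1 else 0 :=
  dif_neg fun h => hm h.2

theorem act_blockExt_of_notMem (M : Matrix (LowMode N) (LowMode N) ℂ) (a : ℤ → ℂ) {n : ℤ}
    (hn : n ∉ Finset.Icc (-(N : ℤ)) N) : act (blockExt M) a n = a n := by
  rw [act, tsum_eq_single n]
  · simp [blockExt_of_row_notMem M hn]
  · intro m hm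
    simp [blockExt_of_row_notMem M hn, hm.symm]

theorem act_blockExt_low (M : Matrix (LowMode N) (LowMode N) ℂ) (a : ℤ → ℂ) (n : LowMode N) :
    act (blockExt M) a n = ∑ m : LowMode N, M n m * a m := by
  rw [act, tsum_eq_sum (s := Finset.Icc (-(N : ℤ)) N), ← Finset.sum_coe_sort]
  · exact Finset.sum_congr rfl fun m _ => by rw [blockExt_low M n m]
  · intro m hm
    rw [blockExt_of_col_notMem M n hm, if_neg, zero_mul]
    rintro rfl
    exact hm n.2

theorem act_blockExt_add (M : Matrix (LowMode N) (LowMode N) ℂ) (a b : ℤ → ℂ) :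
    act (blockExt M) (a + b) = act (blockExt M) a + act (blockExt M) b := by
  funext n
  rw [Pi.add_apply]
  by_cases hn : n ∈ Finset.Icc (-(N : ℤ)) N
  · lift n to LowMode N using hn
    simp only [act_blockExt_low, Pi.add_apply, mul_add, Finset.sum_add_distrib]
  · simp only [act_blockExt_of_notMem M _ hn, Pi.add_apply]

theorem act_smul (A : ℤ → ℤ → ℂ) (c : ℂ) (a : ℤ → ℂ) : act A (c • a) = c • act A a := by
  funext n
  simp only [act, Pi.smul_apply, smul_eq_mul, ← tsum_mul_left]
  exact tsum_congr fun m => by ring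

/-- A block matrix as a linear map on arbitrary sequences. -/
def blockExtLin (M : Matrix (LowMode N) (LowMode N) ℂ) : (ℤ → ℂ) →ₗ[ℂ] (ℤ → ℂ) where
  toFun := act (blockExt M)
  map_add' := act_blockExt_add M
  map_smul' := act_smul _

theorem act_blockExt_mul (M M' : Matrix (LowMode N) (LowMode N) ℂ) (a : ℤ → ℂ) :
    act (blockExt M) (act (blockExt M') a) = act (blockExt (M * M')) a := by
  funext n
  by_cases hn : n ∈ Finset.Icc (-(N : ℤ)) N
  · lift n to LowMode N using hn
    simp only [act_blockExt_low, Matrix.mul_apply, Finset.mul_sum, Finset.sum_mul]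
    rw [Finset.sum_comm]
    simp only [mul_assoc]
  · simp only [act_blockExt_of_notMem _ _ hn]

theorem act_blockExt_one (a : ℤ → ℂ) :
    act (blockExt (1 : Matrix (LowMode N) (LowMode N) ℂ)) a = a := by
  funext n
  by_cases hn : n ∈ Finset.Icc (-(N : ℤ)) N
  · lift n to LowMode N using hn
    rw [act_blockExt_low, Finset.sum_eq_single n] <;> simp +contextual [Matrix.one_apply_ne']
  · rw [act_blockExt_of_notMem _ _ hn]

theorem enorm_act_blockExt_le (M : Matrix (LowMode N) (LowMode N) ℂ) (a : ℤ → ℂ) (n : ℤ) :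
    ‖act (blockExt M) a n‖ₑ ≤ actE (fun n m => ‖blockExt M n m‖ₑ) (fun m => ‖a m‖ₑ) n := by
  rw [act, actE]
  simp only [← enorm_mul]
  exact enorm_tsum_le_tsum_enorm

end BlockExt

/-! ### Nonnegative matrices -/

theorem actE_mono (A : ℤ → ℤ → ℝ≥0∞) {a b : ℤ → ℝ≥0∞} (h : ∀ m, a m ≤ b m) (n : ℤ) :
    actE A a n ≤ actE A b n :=
  ENNReal.tsum_le_tsum fun m => mul_le_mul_right (h m) _

theorem actE_add (A : ℤ → ℤ → ℝ≥0∞) (a b : ℤ → ℝ≥0∞) (n : ℤ) :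
    actE A (fun m => a m + b m) n = actE A a n + actE A b n := by
  simp only [actE, mul_add, ENNReal.tsum_add]

theorem actE_const_mul (A : ℤ → ℤ → ℝ≥0∞) (c : ℝ≥0∞) (a : ℤ → ℝ≥0∞) (n : ℤ) :
    actE A (fun m => c * a m) n = c * actE A a n := by
  simp only [actE, ← ENNReal.tsum_mul_left]
  exact tsum_congr fun m => by ring

theorem actE_mulE (A B : ℤ → ℤ → ℝ≥0∞) (a : ℤ → ℝ≥0∞) (n : ℤ) :
    actE (mulE A B) a n = actE A (actE B a) n := by
  simp only [actE, mulE, ← ENNReal.tsum_mul_left, ← ENNReal.tsum_mul_right]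
  rw [ENNReal.tsum_comm]
  exact tsum_congr fun m => tsum_congr fun k => by ring

theorem normE_mono (ν : ℝ) {a b : ℤ → ℝ≥0∞} (h : ∀ m, a m ≤ b m) : normE ν a ≤ normE ν b :=
  ENNReal.tsum_le_tsum fun m => mul_le_mul_left (h m) _

theorem normE_add (ν : ℝ) (a b : ℤ → ℝ≥0∞) :
    normE ν (fun n => a n + b n) = normE ν a + normE ν b := by
  simp only [normE, add_mul, ENNReal.tsum_add]

theorem normE_const_mul (ν : ℝ) (c : ℝ≥0∞) (a : ℤ → ℝ≥0∞) :
    normE ν (fun n => c * a n) = c * normE ν a := by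
  simp only [normE, mul_assoc, ENNReal.tsum_mul_left]

theorem normE_sum {ι : Type*} (ν : ℝ) (s : Finset ι) (a : ι → ℤ → ℝ≥0∞) :
    normE ν (fun n => ∑ i ∈ s, a i n) = ∑ i ∈ s, normE ν (a i) := by
  simp only [normE, Finset.sum_mul]
  exact Summable.tsum_finsetSum fun _ _ => ENNReal.summable

theorem normE_actE_eq_tsum (ν : ℝ) (A : ℤ → ℤ → ℝ≥0∞) (a : ℤ → ℝ≥0∞) :
    normE ν (actE A a) = ∑' m : ℤ, normE ν (fun n => A n m) * a m := by
  simp only [normE, actE, ← ENNReal.tsum_mul_right]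
  rw [ENNReal.tsum_comm]
  exact tsum_congr fun m => tsum_congr fun k => by ring

/-- The norm of a matrix is controlled by those of its columns. -/
theorem normE_actE_le_of_col_le {ν : ℝ} {A : ℤ → ℤ → ℝ≥0∞} {C : ℝ≥0∞} (a : ℤ → ℝ≥0∞)
    (h : ∀ m, normE ν (fun n => A n m) ≤ C * ENNReal.ofReal ν ^ m.natAbs) :
    normE ν (actE A a) ≤ C * normE ν a := by
  rw [normE_actE_eq_tsum, normE, ← ENNReal.tsum_mul_left]
  refine ENNReal.tsum_le_tsum fun m => ?_
  rw [mul_comm (a m), ← mul_assoc]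
  exact mul_le_mul_left (h m) _

theorem ofReal_pow_ne_top {ν : ℝ} (k : ℕ) : ENNReal.ofReal ν ^ k ≠ ∞ :=
  ENNReal.pow_ne_top ENNReal.ofReal_ne_top

section

variable {ν : ℝ} [hν : Fact (1 ≤ ν)]

theorem ofReal_pow_ne_zero (k : ℕ) : ENNReal.ofReal ν ^ k ≠ 0 :=
  pow_ne_zero _ (zero_lt_one.trans_le Ell1.one_le_ofReal).ne'

/-- Tested on the unit vector ν^(-|m|) e_m. With `normE_actE_le_of_col_le` this extends the operator
bound to all nonnegative sequences, including those of infinite norm. -/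
theorem normE_col_le_opNormE (A : ℤ → ℤ → ℝ≥0∞) (m : ℤ) :
    normE ν (fun n => A n m) ≤ opNormE ν A * ENNReal.ofReal ν ^ m.natAbs := by
  let c : ℂ := ((ν ^ m.natAbs : ℝ) : ℂ)⁻¹
  have hc : ‖c‖ₑ = (ENNReal.ofReal ν ^ m.natAbs)⁻¹ := by
    rw [← ofReal_norm, norm_inv, Complex.norm_real, Real.norm_eq_abs,
      abs_of_pos (Ell1.weight_pos m), ENNReal.ofReal_inv_of_pos (Ell1.weight_pos m),
      Ell1.ofReal_weight]
  have hn : ‖c • (Ell1.basis m : Ell1 ν)‖ ≤ 1 := by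
    rw [norm_smul, norm_inv, Complex.norm_real, Ell1.norm_basis, Real.norm_eq_abs,
      abs_of_pos (Ell1.weight_pos m), inv_mul_cancel₀ (Ell1.weight_pos m).ne']
  have h : normE ν (actE A fun n => ‖(c • (Ell1.basis m : Ell1 ν)) n‖ₑ) ≤ opNormE ν A :=
    le_iSup₂_of_le (c • (Ell1.basis m : Ell1 ν)) hn le_rfl
  rw [normE_actE_eq_tsum, tsum_eq_single m, Ell1.smul_apply, Ell1.basis_apply, if_pos rfl,
    mul_one, hc, ← div_eq_mul_inv] at h
  · exact (ENNReal.div_le_iff (ofReal_pow_ne_zero _) (ofReal_pow_ne_top _)).1 h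
  · intro k hk
    rw [Ell1.smul_apply, Ell1.basis_apply, if_neg hk, mul_zero, enorm_zero, mul_zero]

theorem normE_actE_le_opNormE (A : ℤ → ℤ → ℝ≥0∞) (a : ℤ → ℝ≥0∞) :
    normE ν (actE A a) ≤ opNormE ν A * normE ν a :=
  normE_actE_le_of_col_le a (normE_col_le_opNormE A)

/-- Only the finiteness of the constant matters: block matrices preserve ℓ¹_ν. -/
theorem normE_col_blockExt_le {N : ℕ} (M : Matrix (LowMode N) (LowMode N) ℂ) (m : ℤ) :
    normE ν (fun n => ‖blockExt M n m‖ₑ)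
      ≤ (1 + ENNReal.ofReal ν ^ N * ∑ m : LowMode N, ∑ n : LowMode N, ‖M n m‖ₑ)
        * ENNReal.ofReal ν ^ m.natAbs := by
  by_cases hm : m ∈ Finset.Icc (-(N : ℤ)) N
  · lift m to LowMode N using hm
    rw [normE, tsum_eq_sum (s := Finset.Icc (-(N : ℤ)) N), ← Finset.sum_coe_sort]
    · calc ∑ n : LowMode N, ‖blockExt M n m‖ₑ * ENNReal.ofReal ν ^ (n : ℤ).natAbs
          ≤ ∑ n : LowMode N, ‖M n m‖ₑ * ENNReal.ofReal ν ^ N := by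
            refine Finset.sum_le_sum fun n _ => ?_
            rw [blockExt_low]
            gcongr
            · exact Ell1.one_le_ofReal
            · exact lowMode_iff.1 n.2
        _ = (ENNReal.ofReal ν ^ N * ∑ n : LowMode N, ‖M n m‖ₑ) * 1 := by
            rw [← Finset.sum_mul, mul_one, mul_comm]
        _ ≤ _ := by
            refine mul_le_mul' (le_add_of_nonneg_of_le zero_le_one ?_)
              (one_le_pow₀ Ell1.one_le_ofReal)
            exact mul_le_mul_right (Finset.single_le_sum
              (f := fun m => ∑ n : LowMode N, ‖M n m‖ₑ) (fun _ _ => zero_le)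
              (Finset.mem_univ m)) _
    · intro n hn
      rw [blockExt_of_row_notMem M hn, if_neg, enorm_zero, zero_mul]
      rintro rfl
      exact hn m.2
  · rw [normE, tsum_eq_single m]
    · rw [blockExt_of_col_notMem M m hm, if_pos rfl, enorm_one]
      gcongr
      exact le_self_add
    · intro n hn
      rw [blockExt_of_col_notMem M n hm, if_neg hn, enorm_zero, zero_mul]

theorem exists_normE_actE_blockExt_le {N : ℕ} (M : Matrix (LowMode N) (LowMode N) ℂ) :
    ∃ C : ℝ≥0∞, C ≠ ∞ ∧
      ∀ a, normE ν (actE (fun n m => ‖blockExt M n m‖ₑ) a) ≤ C * normE ν a := by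
  refine ⟨_, ?_, fun a => normE_actE_le_of_col_le a (normE_col_blockExt_le M)⟩
  refine ENNReal.add_ne_top.2 ⟨ENNReal.one_ne_top, ENNReal.mul_ne_top (ofReal_pow_ne_top _) ?_⟩
  exact ENNReal.sum_ne_top.2 fun _ _ => ENNReal.sum_ne_top.2 fun _ _ => enorm_ne_top

end

namespace Setup

variable {ν : ℝ} [hν : Fact (1 ≤ ν)] (S : Setup ν)

/-! ### The operator `𝓛` -/

theorem act_Qinv_act_Qmat (a : ℤ → ℂ) : act S.Qinv (act S.Qmat a) = a := by
  rw [Qinv, Qmat, act_blockExt_mul, ← Matrix.GeneralLinearGroup.coe_mul, inv_mul_cancel,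
    Matrix.GeneralLinearGroup.coe_one, act_blockExt_one]

theorem act_Qmat_act_Qinv (a : ℤ → ℂ) : act S.Qmat (act S.Qinv a) = a := by
  rw [Qinv, Qmat, act_blockExt_mul, ← Matrix.GeneralLinearGroup.coe_mul, mul_inv_cancel,
    Matrix.GeneralLinearGroup.coe_one, act_blockExt_one]

/-- The operator `Q diag(w) Q⁻¹` on arbitrary sequences. -/
def conjDiag (w : ℤ → ℂ) : (ℤ → ℂ) →ₗ[ℂ] (ℤ → ℂ) :=
  blockExtLin (S.Q : Matrix (LowMode S.N) (LowMode S.N) ℂ) ∘ₗ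
    LinearMap.pi (fun n => w n • LinearMap.proj n) ∘ₗ
    blockExtLin ((S.Q⁻¹ : Matrix.GeneralLinearGroup (LowMode S.N) ℂ) :
      Matrix (LowMode S.N) (LowMode S.N) ℂ)

theorem conjDiag_apply (w a : ℤ → ℂ) :
    S.conjDiag w a = act S.Qmat fun n => w n * act S.Qinv a n := rfl

theorem L_eq_conjDiag (a : ℤ → ℂ) : S.L a = S.conjDiag S.lam a := rfl

/-- The functional calculus of 𝓛 on arbitrary sequences: 𝓛 - z and its inverse are both of this
form, and no summability is needed because Q differs from the identity only on a finite block. -/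
theorem conjDiag_conjDiag (w w' a : ℤ → ℂ) :
    S.conjDiag w (S.conjDiag w' a) = S.conjDiag (fun n => w n * w' n) a := by
  simp only [conjDiag_apply, act_Qinv_act_Qmat, mul_assoc]

theorem conjDiag_one (a : ℤ → ℂ) : S.conjDiag (fun _ => 1) a = a := by
  simp only [conjDiag_apply, one_mul, act_Qmat_act_Qinv]

theorem conjDiag_lam_sub (z : ℂ) (a : ℤ → ℂ) :
    S.conjDiag (fun n => S.lam n - z) a = S.L a - z • a := by
  have h : S.conjDiag (fun _ => z) a = z • a := by
    conv_rhs => rw [← S.conjDiag_one a, ← LinearMap.map_smul]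
    rw [conjDiag_apply, conjDiag_apply]
    congr 1
    funext n
    rw [Qinv, act_smul]
    simp
  rw [← h, L_eq_conjDiag, conjDiag_apply, conjDiag_apply, conjDiag_apply]
  refine Eq.trans ?_ (map_sub (blockExtLin _) _ _)
  refine congrArg _ ?_
  funext n
  exact sub_mul _ _ _

theorem conjDiag_inv_conjDiag {w : ℤ → ℂ} (hw : ∀ n, w n ≠ 0) (a : ℤ → ℂ) :
    S.conjDiag (fun n => (w n)⁻¹) (S.conjDiag w a) = a := by
  rw [conjDiag_conjDiag]
  simp only [inv_mul_cancel₀ (hw _), conjDiag_one]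

theorem conjDiag_conjDiag_inv {w : ℤ → ℂ} (hw : ∀ n, w n ≠ 0) (a : ℤ → ℂ) :
    S.conjDiag w (S.conjDiag (fun n => (w n)⁻¹) a) = a := by
  rw [conjDiag_conjDiag]
  simp only [mul_inv_cancel₀ (hw _), conjDiag_one]

/-- The eigenvector is the n-th column of Q. This turns the spectral hypothesis on 𝓛 into Re λ_n < 0
for every n. -/
theorem isEigenvalueL_lam (n : ℤ) : S.IsEigenvalueL (S.lam n) := by
  obtain ⟨C, hC, h⟩ := exists_normE_actE_blockExt_le (ν := ν)
    (S.Q : Matrix (LowMode S.N) (LowMode S.N) ℂ)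
  let e : ℤ → ℂ := (Ell1.basis n : Ell1 ν)
  have hf : normE ν (fun k => ‖act S.Qmat e k‖ₑ) ≠ ∞ := by
    refine ne_top_of_le_ne_top ?_
      ((normE_mono ν (enorm_act_blockExt_le _ e)).trans (h fun k => ‖e k‖ₑ))
    rw [← Ell1.enorm_eq_normE]
    exact ENNReal.mul_ne_top hC enorm_ne_top
  have hv : (Ell1.ofSeq ν (act S.Qmat e) : ℤ → ℂ) = act S.Qmat e :=
    funext fun k => Ell1.ofSeq_apply hf k
  refine ⟨Ell1.ofSeq ν (act S.Qmat e), fun h0 => ?_, fun k => ?_⟩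
  · have h1 : e = 0 := by
      rw [← S.act_Qinv_act_Qmat e, ← hv, h0]
      exact map_zero (blockExtLin _)
    have h2 := congrFun h1 n
    simp [e, Ell1.basis_apply] at h2
  · rw [hv, L, act_Qinv_act_Qmat, ← smul_eq_mul, ← Pi.smul_apply, ← act_smul]
    congr 2
    funext k
    simp only [e, Ell1.basis_apply, Pi.smul_apply, smul_eq_mul]
    split_ifs with hk
    · rw [hk]
    · simp

theorem lam_of_lt {n : ℤ} (hn : S.N < n.natAbs) :
    S.lam n = -(n : ℂ) ^ (2 * S.J)
      + ∑ j ∈ Finset.range (2 * S.J), (Complex.I * (n : ℂ)) ^ j * S.vbar j :=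
  dif_neg fun h => by have := lowMode_iff.1 h; omega

theorem norm_I_mul_intCast_pow (n : ℤ) (j : ℕ) :
    ‖(Complex.I * (n : ℂ)) ^ j‖ = (n.natAbs : ℝ) ^ j := by
  rw [norm_pow, norm_mul, Complex.norm_I, one_mul, Complex.norm_intCast, Nat.cast_natAbs,
    Int.cast_abs]

/-- For large `|n|`, the leading term of `λ_n` dominates. -/
theorem exists_re_lam_le_neg_one : ∃ M : ℕ, ∀ n : ℤ, M < n.natAbs → (S.lam n).re ≤ -1 := by
  let c : ℝ := ∑ j ∈ Finset.range (2 * S.J), ‖S.vbar j‖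
  -- With x = |n| ≥ c + 1, the lower-order terms are at most c x^(2J-1), so Re λ_n ≤ x^(2J-1) (c -
  -- x) ≤ -1.
  refine ⟨max S.N (⌈c⌉₊ + 1), fun n hn => ?_⟩
  have hN : S.N < n.natAbs := (le_max_left _ _).trans_lt hn
  have hc : ⌈c⌉₊ + 1 < n.natAbs := (le_max_right _ _).trans_lt hn
  have hJ := S.one_le_J
  have hx1 : (1 : ℝ) ≤ n.natAbs := by exact_mod_cast (by omega : 1 ≤ n.natAbs)
  have hxc : c + 1 ≤ n.natAbs := by
    refine (add_le_add_left (Nat.le_ceil c) 1).trans ?_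
    exact_mod_cast hc.le
  set x : ℝ := (n.natAbs : ℝ) with hx
  have h1 : ((n : ℂ) ^ (2 * S.J)).re = x ^ (2 * S.J) := by
    rw [← Complex.ofReal_intCast, ← Complex.ofReal_pow, Complex.ofReal_re, hx, Nat.cast_natAbs,
      Int.cast_abs, pow_mul, pow_mul, sq_abs]
  have h2 : ‖∑ j ∈ Finset.range (2 * S.J), (Complex.I * (n : ℂ)) ^ j * S.vbar j‖
      ≤ x ^ (2 * S.J - 1) * c := by
    rw [Finset.mul_sum]
    refine norm_sum_le_of_le _ fun j hj => ?_
    rw [norm_mul, norm_I_mul_intCast_pow]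
    have := Finset.mem_range.1 hj
    exact mul_le_mul_of_nonneg_right (pow_le_pow_right₀ hx1 (by omega)) (norm_nonneg _)
  have h3 : x ^ (2 * S.J) = x ^ (2 * S.J - 1) * x := by
    rw [← pow_succ]
    congr 1
    omega
  have h4 : 1 ≤ x ^ (2 * S.J - 1) := one_le_pow₀ hx1
  rw [S.lam_of_lt hN, Complex.add_re, Complex.neg_re, h1, h3]
  have h5 := (Complex.re_le_norm _).trans h2
  nlinarith

/-- Only finitely many λ_n can have real part above -1, so negativity of each one is automatically
uniform. -/
theorem exists_le_neg_re_lam (h : ∀ n, (S.lam n).re < 0) :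
    ∃ δ : ℝ, 0 < δ ∧ ∀ n, δ ≤ -(S.lam n).re := by
  obtain ⟨M, hM⟩ := S.exists_re_lam_le_neg_one
  obtain ⟨k, -, hk⟩ := (Finset.Icc (-(M : ℤ)) M).exists_min_image (fun n => -(S.lam n).re)
    ⟨0, by simp⟩
  refine ⟨min 1 (-(S.lam k).re), lt_min one_pos (neg_pos.2 (h k)), fun n => ?_⟩
  by_cases hn : n ∈ Finset.Icc (-(M : ℤ)) M
  · exact (min_le_right _ _).trans (hk n hn)
  · refine (min_le_left _ _).trans ?_
    have := hM n (by rw [lowMode_iff] at hn; omega)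
    linarith

end Setup

/-! ### Continuity for coefficientwise convergence. -/

theorem continuous_act_blockExt {N : ℕ} (M : Matrix (LowMode N) (LowMode N) ℂ) :
    Continuous (act (blockExt M)) := by
  refine continuous_pi fun n => ?_
  by_cases hn : n ∈ Finset.Icc (-(N : ℤ)) N
  · lift n to LowMode N using hn
    simp only [act_blockExt_low]
    fun_prop
  · simp only [act_blockExt_of_notMem M _ hn]
    fun_prop

theorem act_blockExt_of_forall_low {N : ℕ} (M : Matrix (LowMode N) (LowMode N) ℂ) {a : ℤ → ℂ}
    (ha : ∀ n ∈ Finset.Icc (-(N : ℤ)) N, a n = 0) : act (blockExt M) a = a := by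
  funext n
  by_cases hn : n ∈ Finset.Icc (-(N : ℤ)) N
  · rw [ha n hn]
    lift n to LowMode N using hn
    rw [act_blockExt_low]
    exact Finset.sum_eq_zero fun m _ => by rw [ha m m.2, mul_zero]
  · exact act_blockExt_of_notMem M a hn

theorem continuous_coeffs {ν : ℝ} [Fact (1 ≤ ν)] :
    Continuous fun h : Ell1 ν => (h : ℤ → ℂ) :=
  continuous_pi fun n => (Ell1.coeffL n).continuous

namespace Setup

variable {ν : ℝ} [hν : Fact (1 ≤ ν)] (S : Setup ν)

/-! ### Decomposition of `γ` and `Dγ` -/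

theorem D_sub (j : ℕ) (a b : ℤ → ℂ) (n : ℤ) : D j (a - b) n = D j a n - D j b n := mul_sub _ _ _

theorem DF_apply (u h : Ell1 ν) (n : ℤ) : S.DF u h n = (-1) ^ (S.J + 1) * D (2 * S.J) h n
    + ∑ j ∈ Finset.range (2 * S.J), D j (Ell1.poly (Polynomial.derivative (S.g j)) u * h : Ell1 ν) n := rfl

/-- `Dγ(u)` as a linear map. -/
def DgamLin (u : Ell1 ν) : Ell1 ν →ₗ[ℂ] (ℤ → ℂ) := S.DF u - S.conjDiag S.lam ∘ₗ coeffs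

theorem DgamLin_apply (u h : Ell1 ν) : S.DgamLin u h = S.Dgam u h := rfl

/-- The target carries the product topology: despite the loss of derivatives, each coefficient of
DF(u)h is continuous in h. This permits expanding Dγ(ū)h along the basis. -/
theorem continuous_DF (u : Ell1 ν) : Continuous fun h => S.DF u h := by
  refine continuous_pi fun n => ?_
  simp only [DF_apply, D]
  have h1 : Continuous fun h : Ell1 ν => h n := (Ell1.coeffL n).continuous
  have h2 : ∀ c : Ell1 ν, Continuous fun h : Ell1 ν => (c * h) n := fun c =>
    h1.comp (continuous_const.mul continuous_id)
  exact (continuous_const.mul (continuous_const.mul h1)).add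
    (continuous_finsetSum _ fun j _ => continuous_const.mul (h2 _))

theorem continuous_conjDiag (w : ℤ → ℂ) : Continuous (S.conjDiag w) := by
  have h : Continuous fun (a : ℤ → ℂ) (n : ℤ) => w n * a n :=
    continuous_pi fun n => continuous_const.mul (continuous_apply n)
  exact (continuous_act_blockExt _).comp (h.comp (continuous_act_blockExt _))

theorem continuous_DgamLin (u : Ell1 ν) : Continuous (S.DgamLin u) :=
  (S.continuous_DF u).sub ((S.continuous_conjDiag _).comp continuous_coeffs)

theorem Dgam_eq_add_sum (u h : Ell1 ν) : S.Dgam u h = S.Dgam S.ubar h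
    + ∑ j ∈ Finset.range (2 * S.J), D j ((Ell1.poly (Polynomial.derivative (S.g j)) u
      - Ell1.poly (Polynomial.derivative (S.g j)) S.ubar) * h : Ell1 ν) := by
  funext n
  have hj : ∀ j, D j ((Ell1.poly (Polynomial.derivative (S.g j)) u
      - Ell1.poly (Polynomial.derivative (S.g j)) S.ubar) * h : Ell1 ν) n
      = D j (Ell1.poly (Polynomial.derivative (S.g j)) u * h : Ell1 ν) n
        - D j (Ell1.poly (Polynomial.derivative (S.g j)) S.ubar * h : Ell1 ν) n := by
    intro j
    rw [sub_mul]
    exact D_sub j _ _ n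
  rw [Pi.add_apply, Finset.sum_apply, Dgam, Dgam, DF_apply, DF_apply]
  simp only [hj, Finset.sum_sub_distrib]
  ring

/-- The leading derivative and 𝓛 are linear, hence absorbed by Dγ(ū)(u - w). Only the Taylor
remainders of the g^{(j)} are left. -/
theorem gam_sub_gam (u w : Ell1 ν) : S.gam u - S.gam w = S.Dgam S.ubar (u - w)
    + ∑ j ∈ Finset.range (2 * S.J), D j (Ell1.poly (S.g j) u - Ell1.poly (S.g j) w
      - Ell1.poly (Polynomial.derivative (S.g j)) S.ubar * (u - w) : Ell1 ν) := by
  funext n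
  have hj : ∀ j, D j (Ell1.poly (S.g j) u - Ell1.poly (S.g j) w
      - Ell1.poly (Polynomial.derivative (S.g j)) S.ubar * (u - w) : Ell1 ν) n
      = D j (Ell1.poly (S.g j) u) n - D j (Ell1.poly (S.g j) w) n
        - D j (Ell1.poly (Polynomial.derivative (S.g j)) S.ubar * (u - w) : Ell1 ν) n := by
    intro j
    simp only [D, Ell1.sub_apply, mul_sub]
  have hL : S.L (u - w : Ell1 ν) n = S.L u n - S.L w n :=
    congrFun (map_sub (S.conjDiag S.lam) (u : ℤ → ℂ) w) n
  rw [Pi.add_apply, Pi.sub_apply, Finset.sum_apply, Dgam, gam, gam, F, F, DF_apply, hL]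
  have hD : D (2 * S.J) (u - w : Ell1 ν) n = D (2 * S.J) u n - D (2 * S.J) w n := D_sub _ _ _ n
  simp only [hj, Finset.sum_sub_distrib, hD]
  ring

/-! ### The norm controlling `(𝓛 - z)⁻¹` -/

/-- `‖B |Q⁻¹ a|‖`. -/
def resNorm (a : ℤ → ℂ) : ℝ≥0∞ := normE ν (actE S.B fun k => ‖act S.Qinv a k‖ₑ)

theorem resNorm_zero : S.resNorm 0 = 0 := by
  have h : act S.Qinv 0 = 0 := map_zero (blockExtLin _)
  simp [resNorm, h, actE, normE]

theorem resNorm_add_le (a b : ℤ → ℂ) : S.resNorm (a + b) ≤ S.resNorm a + S.resNorm b := by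
  rw [resNorm, resNorm, resNorm, ← normE_add]
  simp only [← actE_add]
  refine normE_mono ν (actE_mono _ fun m => ?_)
  rw [Qinv, act_blockExt_add]
  exact enorm_add_le _ _

/-- The multipliers w enter only through their modulus, so 𝓛⁻¹ and all resolvents under
consideration are controlled by the same `resNorm`. -/
theorem normE_conjDiag_le {w : ℤ → ℂ} {C : ℝ≥0∞} (hw : ∀ n, ‖w n‖ₑ ≤ C / ‖(S.lam n).re‖ₑ)
    (a : ℤ → ℂ) : normE ν (fun n => ‖S.conjDiag w a n‖ₑ) ≤ C * S.resNorm a := by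
  rw [resNorm, ← normE_const_mul]
  refine normE_mono ν fun n => (enorm_act_blockExt_le _ _ n).trans ?_
  rw [← actE_const_mul]
  refine ENNReal.tsum_le_tsum fun m => ?_
  change S.absQ n m * ‖w m * act S.Qinv a m‖ₑ ≤ S.B n m * (C * ‖act S.Qinv a m‖ₑ)
  rw [enorm_mul]
  refine (mul_le_mul_right (mul_le_mul_left (hw m) _) _).trans (le_of_eq ?_)
  rw [B, div_eq_mul_inv, div_eq_mul_inv]
  ring

/-- The derivatives are absorbed by the factor 1/|Re λ_n| inside B; the resulting matrix norm is the
one entering W. -/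
theorem resNorm_D_le (j : ℕ) (c : Ell1 ν) : S.resNorm (D j c)
    ≤ opNormE ν (fun n m => mulE S.B S.absQinv n m * (m.natAbs : ℝ≥0∞) ^ j) * ‖c‖ₑ := by
  rw [Ell1.enorm_eq_normE]
  refine le_trans (normE_mono ν fun n => ?_) (normE_actE_le_opNormE _ _)
  refine (actE_mono _ (enorm_act_blockExt_le _ _) n).trans (le_of_eq ?_)
  rw [← actE_mulE, actE, actE]
  refine tsum_congr fun m => ?_
  rw [D, enorm_mul, ← ofReal_norm ((Complex.I * (m : ℂ)) ^ j), norm_I_mul_intCast_pow,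
    ENNReal.ofReal_pow (by positivity), ENNReal.ofReal_natCast, mul_assoc]
  rfl

/-- A crude constant from the gap δ, needed only to make the resolvent bounded on ℓ¹_ν. -/
theorem exists_resNorm_le (h : ∀ n, (S.lam n).re < 0) :
    ∃ C : ℝ≥0∞, C ≠ ∞ ∧ ∀ a, S.resNorm a ≤ C * normE ν fun n => ‖a n‖ₑ := by
  obtain ⟨δ, hδ, hre⟩ := S.exists_le_neg_re_lam h
  obtain ⟨C₁, h₁, hC₁⟩ := exists_normE_actE_blockExt_le (ν := ν)
    (S.Q : Matrix (LowMode S.N) (LowMode S.N) ℂ)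
  obtain ⟨C₂, h₂, hC₂⟩ := exists_normE_actE_blockExt_le (ν := ν)
    ((S.Q⁻¹ : Matrix.GeneralLinearGroup (LowMode S.N) ℂ) : Matrix (LowMode S.N) (LowMode S.N) ℂ)
  have hδ' : ENNReal.ofReal δ ≠ 0 := by simpa using hδ
  refine ⟨C₁ * ((ENNReal.ofReal δ)⁻¹ * C₂),
    ENNReal.mul_ne_top h₁ (ENNReal.mul_ne_top (ENNReal.inv_ne_top.2 hδ') h₂), fun a => ?_⟩
  calc S.resNorm a
      ≤ normE ν (actE S.absQ fun k => (ENNReal.ofReal δ)⁻¹ * ‖act S.Qinv a k‖ₑ) := by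
        refine normE_mono ν fun n => ENNReal.tsum_le_tsum fun m => ?_
        rw [B, div_eq_mul_inv, mul_assoc]
        have : ENNReal.ofReal δ ≤ ‖(S.lam m).re‖ₑ := by
          rw [← ofReal_norm, Real.norm_eq_abs, abs_of_neg (h m)]
          exact ENNReal.ofReal_le_ofReal (hre m)
        exact mul_le_mul_right (mul_le_mul_left (ENNReal.inv_le_inv.2 this) _) _
    _ ≤ C₁ * normE ν (fun k => (ENNReal.ofReal δ)⁻¹ * ‖act S.Qinv a k‖ₑ) := hC₁ _
    _ = C₁ * ((ENNReal.ofReal δ)⁻¹ * normE ν fun k => ‖act S.Qinv a k‖ₑ) := by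
        rw [normE_const_mul]
    _ ≤ C₁ * ((ENNReal.ofReal δ)⁻¹ * (C₂ * normE ν fun n => ‖a n‖ₑ)) := by
        gcongr
        exact (normE_mono ν (enorm_act_blockExt_le _ a)).trans (hC₂ _)
    _ = _ := by ring

theorem resNorm_sum_D_le {rs t : ℝ} (ht : 0 ≤ t) (c : ℕ → Ell1 ν)
    (h : ∀ j, ‖c j‖ ≤ absPolyEval (Polynomial.derivative (Polynomial.derivative (S.g j)))
      (‖S.ubar‖ + rs) * t) :
    S.resNorm (∑ j ∈ Finset.range (2 * S.J), D j (c j)) ≤ S.W rs * ENNReal.ofReal t := by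
  refine (Finset.le_sum_of_subadditive S.resNorm S.resNorm_zero.le S.resNorm_add_le _ _).trans ?_
  rw [W, Finset.sum_mul]
  refine Finset.sum_le_sum fun j _ => (S.resNorm_D_le j (c j)).trans ?_
  rw [mul_assoc, ← ENNReal.ofReal_mul' ht, ← ofReal_norm]
  gcongr
  exact h j

/-! ### The bound `Z` -/

/-- Beyond the block, 𝓛 is diagonal, and λ_m consists exactly of the leading symbol and the mean
part of DF(ū). Both cancel, and (g^{(j)})'(ū) keeps only its nonconstant part. -/
theorem Dgam_basis {m : ℤ} (hm : S.N < m.natAbs) (n : ℤ) : S.Dgam S.ubar (Ell1.basis m) n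
    = ∑ j ∈ Finset.range (2 * S.J), (Complex.I * (n : ℂ)) ^ j
      * (Ell1.poly (Polynomial.derivative (S.g j)) S.ubar (n - m)
        - if n - m = 0 then S.vbar j else 0) := by
  have hb : ∀ k ∈ Finset.Icc (-(S.N : ℤ)) S.N, (Ell1.basis m : Ell1 ν) k = 0 := by
    intro k hk
    rw [lowMode_iff] at hk
    rw [Ell1.basis_apply, if_neg]
    rintro rfl
    omega
  have hL : S.L (Ell1.basis m : Ell1 ν) n = S.lam n * (Ell1.basis m : Ell1 ν) n := by
    rw [L, Qinv, act_blockExt_of_forall_low _ hb, Qmat, act_blockExt_of_forall_low]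
    intro k hk
    rw [hb k hk, mul_zero]
  rw [Dgam, hL, DF_apply]
  simp only [D, Ell1.mul_def, Ell1.conv_basis_apply, mul_sub, Finset.sum_sub_distrib]
  by_cases hnm : n = m
  · subst hnm
    have hI : (-1) ^ (S.J + 1) * (Complex.I * (n : ℂ)) ^ (2 * S.J) = -(n : ℂ) ^ (2 * S.J) := by
      rw [mul_pow, pow_mul Complex.I, Complex.I_sq, ← mul_assoc, ← pow_add,
        show S.J + 1 + S.J = 2 * S.J + 1 by ring, pow_succ, pow_mul]
      simp
    simp only [Ell1.basis_apply, if_true, mul_one, sub_self, S.lam_of_lt hm, hI]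
    ring
  · simp [Ell1.basis_apply, hnm, sub_eq_zero]

/-- By the bandwidth condition, column m of Dγ(ū) lives on rows |n| ≥ |m| - Nbar > N, where Q⁻¹ is
the identity. -/
theorem enorm_act_Qinv_Dgam_basis_le {Nbar : ℕ} (hN : S.IsBandwidth Nbar) {m : ℤ}
    (hm : Nbar + S.N < m.natAbs) (n : ℤ) : ‖act S.Qinv (S.Dgam S.ubar (Ell1.basis m)) n‖ₑ
      ≤ ∑ j ∈ Finset.range (2 * S.J), (n.natAbs : ℝ≥0∞) ^ j * S.beta j (n - m) := by
  have hle : ∀ k, ‖S.Dgam S.ubar (Ell1.basis m) k‖ₑ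
      ≤ ∑ j ∈ Finset.range (2 * S.J), (k.natAbs : ℝ≥0∞) ^ j * S.beta j (k - m) := by
    intro k
    rw [S.Dgam_basis (by omega)]
    refine (enorm_sum_le _ _).trans (Finset.sum_le_sum fun j _ => ?_)
    rw [enorm_mul, ← ofReal_norm ((Complex.I * (k : ℂ)) ^ j), norm_I_mul_intCast_pow,
      ENNReal.ofReal_pow (by positivity), ENNReal.ofReal_natCast]
    exact le_rfl
  rw [Qinv, act_blockExt_of_forall_low]
  · exact hle n
  · intro k hk
    rw [lowMode_iff] at hk
    rw [← enorm_eq_zero, ← nonpos_iff_eq_zero]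
    refine (hle k).trans (le_of_eq (Finset.sum_eq_zero fun j hj => ?_))
    rw [hN j (Finset.mem_range.1 hj) _ (by omega), mul_zero]

theorem enorm_act_Qinv_Dgam_le {Nbar : ℕ} (hN : S.IsBandwidth Nbar) {G : ℤ → ℤ → ℝ≥0}
    (hG : S.IsLowBound Nbar G) (h : Ell1 ν) (n : ℤ) :
    ‖act S.Qinv (S.Dgam S.ubar h) n‖ₑ ≤ actE (S.Gam Nbar G) (fun m => ‖h m‖ₑ) n := by
  let M : Matrix (LowMode S.N) (LowMode S.N) ℂ :=
    (S.Q⁻¹ : Matrix.GeneralLinearGroup (LowMode S.N) ℂ)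
  -- Row n of Q⁻¹Dγ(ū) is a continuous functional on ℓ¹_ν, so it may be summed over the columns.
  let φ : Ell1 ν →L[ℂ] ℂ :=
    ⟨LinearMap.proj n ∘ₗ blockExtLin M ∘ₗ S.DgamLin S.ubar,
      (continuous_apply n).comp ((continuous_act_blockExt M).comp (S.continuous_DgamLin S.ubar))⟩
  have hφ : ∀ h, φ h = act S.Qinv (S.Dgam S.ubar h) n := fun _ => rfl
  rw [← hφ, ← (φ.hasSum h.hasSum_basis).tsum_eq]
  refine enorm_tsum_le_tsum_enorm.trans (ENNReal.tsum_le_tsum fun m => ?_)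
  rw [map_smul, smul_eq_mul, enorm_mul, mul_comm]
  refine mul_le_mul_left ?_ _
  rw [Gam]
  split_ifs with hm
  · exact hG n m hm
  · exact S.enorm_act_Qinv_Dgam_basis_le hN (not_le.1 hm) n

/-- Such a column of Γ misses the block, so B acts on it as division by |Re λ_n|, and |n|^j / |Re
λ_n| is at most χ^{(j)}. What remains is a translate of β^{(j)}. -/
theorem mulE_B_Gam_le {Nbar : ℕ} (hN : S.IsBandwidth Nbar) (G : ℤ → ℤ → ℝ≥0) {m : ℤ}
    (hm : Nbar + S.N < m.natAbs) (n : ℤ) : mulE S.B (S.Gam Nbar G) n m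
      ≤ ∑ j ∈ Finset.range (2 * S.J), S.chi j * S.beta j (n - m) := by
  have hlow : ∀ k ∈ Finset.Icc (-(S.N : ℤ)) S.N, S.Gam Nbar G k m = 0 := by
    intro k hk
    rw [lowMode_iff] at hk
    rw [Gam, if_neg hm.not_ge]
    refine Finset.sum_eq_zero fun j hj => ?_
    rw [hN j (Finset.mem_range.1 hj) _ (by omega), mul_zero]
  rw [mulE, tsum_eq_single n]
  · by_cases hn : n ∈ Finset.Icc (-(S.N : ℤ)) S.N
    · rw [hlow n hn, mul_zero]
      exact zero_le
    · rw [B, absQ, Qmat, blockExt_of_row_notMem _ hn, if_pos rfl, enorm_one, Gam,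
        if_neg hm.not_ge, Finset.mul_sum]
      refine Finset.sum_le_sum fun j _ => ?_
      rw [← mul_assoc]
      refine mul_le_mul_left ?_ _
      rw [mul_comm, mul_one_div]
      rw [lowMode_iff, not_le] at hn
      exact le_iSup₂_of_le (f := fun (n : ℤ) (_ : S.N < n.natAbs) =>
        (n.natAbs : ℝ≥0∞) ^ j / ‖(S.lam n).re‖ₑ) n hn le_rfl
  · intro k hk
    by_cases hk' : k ∈ Finset.Icc (-(S.N : ℤ)) S.N
    · rw [hlow k hk', mul_zero]
    · rw [B, absQ, Qmat, blockExt_of_col_notMem _ _ hk', if_neg hk.symm, enorm_zero,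
        ENNReal.zero_div, zero_mul]

/-- An ℓ¹ operator norm is a supremum over columns. The two arguments of the maximum defining Z
handle the low and the high columns. -/
theorem resNorm_Dgam_ubar_le {Nbar : ℕ} (hN : S.IsBandwidth Nbar) {G : ℤ → ℤ → ℝ≥0}
    (hG : S.IsLowBound Nbar G) (h : Ell1 ν) :
    S.resNorm (S.Dgam S.ubar h) ≤ S.Z Nbar G * ‖h‖ₑ := by
  rw [Ell1.enorm_eq_normE]
  calc S.resNorm (S.Dgam S.ubar h)
      ≤ normE ν (actE (mulE S.B (S.Gam Nbar G)) fun m => ‖h m‖ₑ) := by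
        refine normE_mono ν fun n => ?_
        rw [actE_mulE]
        exact actE_mono _ (S.enorm_act_Qinv_Dgam_le hN hG h) n
    _ ≤ _ := normE_actE_le_of_col_le _ fun m => ?_
  by_cases hm : m.natAbs ≤ Nbar + S.N
  · have := normE_col_le_opNormE (ν := ν)
      (fun n m => if m.natAbs ≤ Nbar + S.N then mulE S.B (S.Gam Nbar G) n m else 0) m
    simp only [if_pos hm] at this
    exact this.trans (mul_le_mul_left (le_max_left _ _) _)
  · calc normE ν (fun n => mulE S.B (S.Gam Nbar G) n m)
        ≤ normE ν (fun n => ∑ j ∈ Finset.range (2 * S.J), S.chi j * S.beta j (n - m)) :=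
          normE_mono ν (S.mulE_B_Gam_le hN G (not_le.1 hm))
      _ = ∑ j ∈ Finset.range (2 * S.J), S.chi j * normE ν (fun n => S.beta j (n - m)) := by
          simp only [normE_sum, normE_const_mul]
      _ ≤ ∑ j ∈ Finset.range (2 * S.J),
            S.chi j * (normE ν (S.beta j) * ENNReal.ofReal ν ^ m.natAbs) := by
          gcongr
          exact normE_shift_le _ _
      _ = (∑ j ∈ Finset.range (2 * S.J), normE ν (S.beta j) * S.chi j)
            * ENNReal.ofReal ν ^ m.natAbs := by
          rw [Finset.sum_mul]
          exact Finset.sum_congr rfl fun j _ => by ring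
      _ ≤ _ := mul_le_mul_left (le_max_right _ _) _

end Setup

/-! ### Bounded operators on `ℓ¹_ν` from sequence-valued maps. -/

section Ell1

variable {ν : ℝ} [hν : Fact (1 ≤ ν)]

theorem Ell1.enorm_ofSeq {a : ℤ → ℂ} (ha : normE ν (fun n => ‖a n‖ₑ) ≠ ∞) :
    ‖Ell1.ofSeq ν a‖ₑ = normE ν fun n => ‖a n‖ₑ := by
  simp only [Ell1.enorm_eq_normE, Ell1.ofSeq_apply ha]

theorem normE_bound_ne_top {A : Ell1 ν →ₗ[ℂ] (ℤ → ℂ)} {C : ℝ≥0}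
    (hA : ∀ h, normE ν (fun n => ‖A h n‖ₑ) ≤ C * ‖h‖ₑ) (h : Ell1 ν) :
    normE ν (fun n => ‖A h n‖ₑ) ≠ ∞ :=
  ne_top_of_le_ne_top (ENNReal.mul_ne_top ENNReal.coe_ne_top enorm_ne_top) (hA h)

/-- A sequence-valued linear map that is bounded in `ℓ¹_ν`, as an operator on `ℓ¹_ν`. -/
def Ell1.codRestrict (A : Ell1 ν →ₗ[ℂ] (ℤ → ℂ)) (C : ℝ≥0)
    (hA : ∀ h, normE ν (fun n => ‖A h n‖ₑ) ≤ C * ‖h‖ₑ) : Ell1 ν →L[ℂ] Ell1 ν :=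
  LinearMap.mkContinuous
    { toFun := fun h => Ell1.ofSeq ν (A h)
      map_add' := fun h k => Ell1.ext fun n => by
        rw [Ell1.add_apply, Ell1.ofSeq_apply (normE_bound_ne_top hA _),
          Ell1.ofSeq_apply (normE_bound_ne_top hA _), Ell1.ofSeq_apply (normE_bound_ne_top hA _),
          map_add, Pi.add_apply]
      map_smul' := fun c h => Ell1.ext fun n => by
        rw [RingHom.id_apply, Ell1.smul_apply, Ell1.ofSeq_apply (normE_bound_ne_top hA _),
          Ell1.ofSeq_apply (normE_bound_ne_top hA _), map_smul, Pi.smul_apply, smul_eq_mul] }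
    C fun h => by
      have h1 := hA h
      rw [← Ell1.enorm_ofSeq (normE_bound_ne_top hA h)] at h1
      rw [enorm_eq_nnnorm, enorm_eq_nnnorm, ← ENNReal.coe_mul, ENNReal.coe_le_coe] at h1
      exact NNReal.coe_le_coe.2 h1

theorem Ell1.codRestrict_apply (A : Ell1 ν →ₗ[ℂ] (ℤ → ℂ)) (C : ℝ≥0)
    (hA : ∀ h, normE ν (fun n => ‖A h n‖ₑ) ≤ C * ‖h‖ₑ) (h : Ell1 ν) (n : ℤ) :
    Ell1.codRestrict A C hA h n = A h n :=
  Ell1.ofSeq_apply (normE_bound_ne_top hA h) n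

theorem Ell1.norm_codRestrict_le (A : Ell1 ν →ₗ[ℂ] (ℤ → ℂ)) (C : ℝ≥0)
    (hA : ∀ h, normE ν (fun n => ‖A h n‖ₑ) ≤ C * ‖h‖ₑ) : ‖Ell1.codRestrict A C hA‖ ≤ C :=
  LinearMap.mkContinuous_norm_le _ C.2 _

end Ell1

namespace Setup

variable {ν : ℝ} [hν : Fact (1 ≤ ν)] (S : Setup ν)

variable {Nbar : ℕ} {G : ℤ → ℤ → ℝ≥0}

/-- |λ_n - z| ≥ Re z - Re λ_n ≥ |Re λ_n| - (1-κ)δ ≥ κ|Re λ_n|, because δ ≤ |Re λ_n|. Comparing real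
parts makes the bound independent of Im z. -/
theorem enorm_inv_lam_sub_le {δ κ : ℝ} (hδ : 0 < δ) (hκ : 0 < κ) (hκ1 : κ ≤ 1)
    (h : ∀ n, δ ≤ -(S.lam n).re) {z : ℂ} (hz : -((1 - κ) * δ) ≤ z.re) (n : ℤ) :
    S.lam n - z ≠ 0 ∧
      ‖(S.lam n - z)⁻¹‖ₑ ≤ (ENNReal.ofReal κ)⁻¹ / ‖(S.lam n).re‖ₑ := by
  have hn := h n
  have h1 : κ * |(S.lam n).re| ≤ |(S.lam n - z).re| := by
    rw [abs_of_neg (by linarith), Complex.sub_re, abs_of_nonpos] <;> nlinarith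
  have h2 : 0 < κ * |(S.lam n).re| := mul_pos hκ (abs_pos.2 (by linarith))
  have h3 := h1.trans (Complex.abs_re_le_norm _)
  have h0 : S.lam n - z ≠ 0 := norm_pos_iff.1 (h2.trans_le h3)
  refine ⟨h0, ?_⟩
  rw [enorm_inv h0, div_eq_mul_inv, ← ENNReal.mul_inv (Or.inr enorm_ne_top)
    (Or.inl ENNReal.ofReal_ne_top), ENNReal.inv_le_inv, ← ofReal_norm, ← ofReal_norm,
    ← ENNReal.ofReal_mul hκ.le]
  exact ENNReal.ofReal_le_ofReal h3

/-! ### Steady states -/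

theorem isSteadyState_iff (h : ∀ n, S.lam n ≠ 0) (u : Ell1 ν) :
    S.IsSteadyState u ↔ (u : ℤ → ℂ) = -S.Linv (S.gam u) := by
  have h1 : S.IsSteadyState u ↔ S.gam u = -S.L u := by
    rw [funext_iff]
    refine forall_congr' fun n => ?_
    rw [gam, Pi.neg_apply, sub_eq_neg_self]
  have hL : ∀ a, S.L (S.Linv a) = a := fun a => S.conjDiag_conjDiag_inv h a
  have hL' : ∀ a, S.Linv (S.L a) = a := fun a => S.conjDiag_inv_conjDiag h a
  have hneg : ∀ a, S.L (-a) = -S.L a := fun a => map_neg (S.conjDiag S.lam) a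
  have hneg' : ∀ a, S.Linv (-a) = -S.Linv a := fun a =>
    map_neg (S.conjDiag fun n => (S.lam n)⁻¹) a
  rw [h1]
  constructor
  · intro hu
    rw [hu, hneg', neg_neg, hL']
  · intro hu
    rw [hu, hneg, neg_neg, hL]

theorem resNorm_gam_sub_gam_le (hN : S.IsBandwidth Nbar) (hG : S.IsLowBound Nbar G)
    {rs : ℝ} {u w : Ell1 ν} (hu : ‖u - S.ubar‖ ≤ rs) (hw : ‖w - S.ubar‖ ≤ rs) :
    S.resNorm (S.gam u - S.gam w) ≤ S.Z Nbar G * ‖u - w‖ₑ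
      + S.W rs * ENNReal.ofReal ((‖u - S.ubar‖ + ‖w - S.ubar‖) / 2 * ‖u - w‖) := by
  have hs : ∀ v : Ell1 ν, ‖v - S.ubar‖ ≤ rs → ‖v‖ ≤ ‖S.ubar‖ + rs := fun v hv => by
    have := norm_add_le S.ubar (v - S.ubar)
    rw [add_sub_cancel] at this
    linarith
  rw [gam_sub_gam]
  refine (S.resNorm_add_le _ _).trans (add_le_add (S.resNorm_Dgam_ubar_le hN hG _) ?_)
  refine S.resNorm_sum_D_le (by positivity) _ fun j => ?_
  rw [← mul_assoc]
  exact Ell1.norm_poly_sub_poly_sub_le (S.g j)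
    (le_add_of_nonneg_right ((norm_nonneg _).trans hu)) (hs u hu) (hs w hw)

/-- Dγ(u) differs from Dγ(ū) only through (g^{(j)})'(u) - (g^{(j)})'(ū), which the mean value
inequality bounds by |(g^{(j)})''|(‖ū‖ + rs) r. -/
theorem resNorm_Dgam_le (hN : S.IsBandwidth Nbar) (hG : S.IsLowBound Nbar G)
    {r rs : ℝ} (hr : 0 ≤ r) (hrs : r ≤ rs) {u : Ell1 ν} (hu : ‖u - S.ubar‖ ≤ r) (h : Ell1 ν) :
    S.resNorm (S.Dgam u h) ≤ (S.Z Nbar G + S.W rs * ENNReal.ofReal r) * ‖h‖ₑ := by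
  have hs : ‖u‖ ≤ ‖S.ubar‖ + rs := by
    have := norm_add_le S.ubar (u - S.ubar)
    rw [add_sub_cancel] at this
    linarith
  have hp : ∀ j, 0 ≤ absPolyEval (Polynomial.derivative (Polynomial.derivative (S.g j)))
      (‖S.ubar‖ + rs) := fun j =>
    Finset.sum_nonneg fun k _ => mul_nonneg (abs_nonneg _)
      (pow_nonneg (add_nonneg (norm_nonneg _) (hr.trans hrs)) _)
  rw [Dgam_eq_add_sum, add_mul, mul_assoc, ← ofReal_norm h, ← ENNReal.ofReal_mul hr, ofReal_norm]
  refine (S.resNorm_add_le _ _).trans (add_le_add (S.resNorm_Dgam_ubar_le hN hG _) ?_)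
  refine S.resNorm_sum_D_le (by positivity) _ fun j => ?_
  refine (norm_mul_le _ _).trans ?_
  rw [← mul_assoc]
  refine mul_le_mul_of_nonneg_right ?_ (norm_nonneg _)
  refine (Ell1.norm_poly_sub_poly_le _ hs
    (le_add_of_nonneg_right (hr.trans hrs))).trans ?_
  exact mul_le_mul_of_nonneg_left hu (hp j)

theorem normE_Linv_le {δ : ℝ} (hδ : 0 < δ) (h : ∀ n, δ ≤ -(S.lam n).re) (a : ℤ → ℂ) :
    normE ν (fun n => ‖S.Linv a n‖ₑ) ≤ S.resNorm a := by
  have := S.normE_conjDiag_le (w := fun n => (S.lam n)⁻¹) (C := 1) (fun n => ?_) a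
  · rwa [one_mul] at this
  · simpa using (S.enorm_inv_lam_sub_le (z := 0) hδ one_pos le_rfl h (by simp) n).2

theorem normE_Linv_sub_le {δ : ℝ} (hδ : 0 < δ) (h : ∀ n, δ ≤ -(S.lam n).re) (a b : ℤ → ℂ) :
    normE ν (fun n => ‖S.Linv a n - S.Linv b n‖ₑ) ≤ S.resNorm (a - b) := by
  have h1 : S.Linv (a - b) = S.Linv a - S.Linv b := map_sub (S.conjDiag fun n => (S.lam n)⁻¹) a b
  refine le_trans (le_of_eq ?_) (S.normE_Linv_le hδ h (a - b))
  simp only [h1, Pi.sub_apply]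

/-- The residual map `u ↦ u + 𝓛⁻¹γ(u)` maps the ball to small sequences. -/
theorem normE_ubar_add_Linv_le (hN : S.IsBandwidth Nbar) (hG : S.IsLowBound Nbar G) {δ : ℝ}
    (hδ : 0 < δ) (h : ∀ n, δ ≤ -(S.lam n).re) (uin : Ell1 ν) {r rs : ℝ} (hrs : r < rs)
    (hself : S.Y uin + S.Z Nbar G * ENNReal.ofReal r + S.W rs * ENNReal.ofReal r ^ 2 / 2
      ≤ ENNReal.ofReal r) {u : Ell1 ν} (hu : ‖u - S.ubar‖ ≤ r) :
    normE ν (fun n => ‖S.ubar n + S.Linv (S.gam u) n‖ₑ) ≤ ENNReal.ofReal r := by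
  have hr : 0 ≤ r := (norm_nonneg _).trans hu
  have h1 : ∀ n, ‖S.ubar n + S.Linv (S.gam u) n‖ₑ
      ≤ ‖S.ubar n + S.Linv (S.gam S.ubar) n‖ₑ
        + ‖S.Linv (S.gam u) n - S.Linv (S.gam S.ubar) n‖ₑ := fun n => by
    refine le_trans (le_of_eq ?_) (enorm_add_le _ _)
    congr 1
    ring
  -- The residual at ū is the second summand in Y.
  have h2 : normE ν (fun n => ‖S.ubar n + S.Linv (S.gam S.ubar) n‖ₑ) ≤ S.Y uin :=
    normE_mono ν fun n => le_add_self
  have h3 : S.resNorm (S.gam u - S.gam S.ubar) ≤ S.Z Nbar G * ENNReal.ofReal r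
      + S.W rs * ENNReal.ofReal r ^ 2 / 2 := by
    refine (S.resNorm_gam_sub_gam_le hN hG (hu.trans hrs.le)
      (by simpa using hr.trans hrs.le)).trans ?_
    -- With w = ū the half-sum of distances is ‖u - ū‖/2, which produces the ½ in ½Wr².
    rw [← ofReal_norm, mul_div_assoc, ← ENNReal.ofReal_pow hr,
      ← ENNReal.ofReal_ofNat 2, ← ENNReal.ofReal_div_of_pos two_pos, sub_self, norm_zero, add_zero,
      div_mul_eq_mul_div, ← sq]
    gcongr
  refine (normE_mono ν h1).trans ?_
  rw [normE_add]
  refine le_trans ?_ hself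
  rw [add_assoc]
  exact add_le_add h2 ((S.normE_Linv_sub_le hδ h _ _).trans h3)

theorem existsUnique_isSteadyState (hN : S.IsBandwidth Nbar) (hG : S.IsLowBound Nbar G) {δ : ℝ}
    (hδ : 0 < δ) (h : ∀ n, δ ≤ -(S.lam n).re) (uin : Ell1 ν) {r rs : ℝ} (hr : 0 < r)
    (hrs : r < rs)
    (hself : S.Y uin + S.Z Nbar G * ENNReal.ofReal r + S.W rs * ENNReal.ofReal r ^ 2 / 2
      ≤ ENNReal.ofReal r)
    (hcontr : S.Z Nbar G + S.W rs * ENNReal.ofReal r < 1) :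
    ∃! u : Ell1 ν, S.IsSteadyState u ∧ ‖u - S.ubar‖ ≤ r := by
  -- This is u ↦ -𝓛⁻¹γ(u), written through the residual ū + 𝓛⁻¹γ(u), whose norm is what the bounds
  -- control. Outside the ball the default value 0 of `Ell1.ofSeq` may occur, but T is only used on
  -- the ball.
  let T : Ell1 ν → Ell1 ν := fun u =>
    S.ubar - Ell1.ofSeq ν fun n => S.ubar n + S.Linv (S.gam u) n
  have hfin : ∀ {u : Ell1 ν}, ‖u - S.ubar‖ ≤ r →
      normE ν (fun n => ‖S.ubar n + S.Linv (S.gam u) n‖ₑ) ≠ ∞ := fun hu =>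
    ne_top_of_le_ne_top ENNReal.ofReal_ne_top
      (S.normE_ubar_add_Linv_le hN hG hδ h uin hrs hself hu)
  have hT : ∀ {u : Ell1 ν}, ‖u - S.ubar‖ ≤ r → ∀ n, T u n = -S.Linv (S.gam u) n := by
    intro u hu n
    rw [Ell1.sub_apply, Ell1.ofSeq_apply (hfin hu)]
    ring
  have hne : ∀ n, S.lam n ≠ 0 := fun n h0 => by
    have := h n
    rw [h0, Complex.zero_re, neg_zero] at this
    exact this.not_gt hδ
  have hsteady : ∀ {u : Ell1 ν}, ‖u - S.ubar‖ ≤ r → (S.IsSteadyState u ↔ T u = u) := by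
    intro u hu
    rw [S.isSteadyState_iff hne, funext_iff]
    refine ⟨fun h => Ell1.ext fun n => ?_, fun h n => ?_⟩
    · rw [hT hu, h n, Pi.neg_apply]
    · rw [Pi.neg_apply, ← hT hu, h]
  have hmaps : Set.MapsTo T (Metric.closedBall S.ubar r) (Metric.closedBall S.ubar r) := by
    intro u hu
    rw [mem_closedBall_iff_norm] at hu ⊢
    have h1 := S.normE_ubar_add_Linv_le hN hG hδ h uin hrs hself hu
    rw [← Ell1.enorm_ofSeq (hfin hu), ← ofReal_norm, ENNReal.ofReal_le_ofReal_iff hr.le] at h1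
    rwa [sub_sub_cancel_left, norm_neg]
  set q : ℝ≥0∞ := S.Z Nbar G + S.W rs * ENNReal.ofReal r with hq
  have hlip : ∀ u w : Ell1 ν, ‖u - S.ubar‖ ≤ r → ‖w - S.ubar‖ ≤ r →
      ‖T u - T w‖ₑ ≤ q * ‖u - w‖ₑ := by
    intro u w hu hw
    rw [Ell1.enorm_eq_normE]
    calc normE ν (fun n => ‖(T u - T w) n‖ₑ)
        = normE ν (fun n => ‖S.Linv (S.gam u) n - S.Linv (S.gam w) n‖ₑ) := by
          congr 1
          funext n
          rw [Ell1.sub_apply, hT hu, hT hw, ← enorm_neg]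
          congr 1
          ring
      _ ≤ S.Z Nbar G * ‖u - w‖ₑ
          + S.W rs * ENNReal.ofReal ((‖u - S.ubar‖ + ‖w - S.ubar‖) / 2 * ‖u - w‖) :=
        (S.normE_Linv_sub_le hδ h _ _).trans
          (S.resNorm_gam_sub_gam_le hN hG (hu.trans hrs.le) (hw.trans hrs.le))
      _ ≤ S.Z Nbar G * ‖u - w‖ₑ + S.W rs * ENNReal.ofReal (r * ‖u - w‖) := by
        gcongr
        linarith
      _ = q * ‖u - w‖ₑ := by
        rw [ENNReal.ofReal_mul hr.le, ofReal_norm, hq]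
        ring
  have hqtop : q ≠ ∞ := hcontr.ne_top
  have hK : q.toNNReal < 1 := by
    rw [← ENNReal.coe_lt_coe, ENNReal.coe_toNNReal hqtop]
    exact hcontr
  have hc : ContractingWith q.toNNReal (hmaps.restrict T _ _) := by
    refine ⟨hK, fun u w => ?_⟩
    rw [Subtype.edist_eq, Subtype.edist_eq, ENNReal.coe_toNNReal hqtop, edist_eq_enorm_sub,
      edist_eq_enorm_sub]
    exact hlip u w (mem_closedBall_iff_norm.1 u.2) (mem_closedBall_iff_norm.1 w.2)
  obtain ⟨u, hu, hfix, -, -⟩ := hc.exists_fixedPoint' Metric.isClosed_closedBall.isComplete hmaps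
    (Metric.mem_closedBall_self hr.le) (edist_ne_top _ _)
  have hu' := mem_closedBall_iff_norm.1 hu
  refine ⟨u, ⟨(hsteady hu').2 hfix, hu'⟩, fun v hv => ?_⟩
  have hfv : T v = v := (hsteady hv.2).1 hv.1
  have h1 := hc.fixedPoint_unique' (x := ⟨v, mem_closedBall_iff_norm.2 hv.2⟩) (y := ⟨u, hu⟩)
    (Subtype.ext hfv) (Subtype.ext hfix)
  exact congrArg Subtype.val h1

/-! ### The spectrum of the linearization -/

theorem DF_sub_smul (u h : Ell1 ν) (z : ℂ) :
    S.DF u h - z • (h : ℤ → ℂ) = S.conjDiag (fun n => S.lam n - z) h + S.Dgam u h := by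
  rw [conjDiag_lam_sub, ← DgamLin_apply, DgamLin, LinearMap.sub_apply, LinearMap.comp_apply,
    L_eq_conjDiag]
  abel

theorem linearization_apply (u : Ell1 ν) (h : (S.linearization u).domain) :
    (S.linearization u h : ℤ → ℂ) = S.DF u h := rfl

/-- With K = (𝓛 - z)⁻¹Dγ(u), of norm at most q/κ < 1, the resolvent is (1 + K)⁻¹(𝓛 - z)⁻¹. -/
theorem mem_unboundedResolventSet {u : Ell1 ν} {z : ℂ} {κ q : ℝ≥0}
    (hlam : ∀ n, (S.lam n).re < 0) (hqκ : q < κ)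
    (hz : ∀ n, S.lam n - z ≠ 0 ∧ ‖(S.lam n - z)⁻¹‖ₑ ≤ (κ : ℝ≥0∞)⁻¹ / ‖(S.lam n).re‖ₑ)
    (hq : ∀ h, S.resNorm (S.Dgam u h) ≤ q * ‖h‖ₑ) :
    z ∈ unboundedResolventSet (S.linearization u) := by
  have hκ : κ ≠ 0 := (zero_le.trans_lt hqκ).ne'
  let R := S.conjDiag fun n => (S.lam n - z)⁻¹
  have hR : ∀ a, normE ν (fun n => ‖R a n‖ₑ) ≤ (κ⁻¹ : ℝ≥0) * S.resNorm a := fun a => by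
    rw [ENNReal.coe_inv hκ]
    exact S.normE_conjDiag_le (fun n => (hz n).2) a
  obtain ⟨C, hC, hC'⟩ := S.exists_resNorm_le hlam
  lift C to ℝ≥0 using hC
  have hK : ∀ h, normE ν (fun n => ‖(R ∘ₗ S.DgamLin u) h n‖ₑ) ≤ (κ⁻¹ * q : ℝ≥0) * ‖h‖ₑ :=
    fun h => (hR _).trans (by
      rw [ENNReal.coe_mul, mul_assoc]
      exact mul_le_mul_right (hq h) _)
  have hR₀ : ∀ h : Ell1 ν, normE ν (fun n => ‖(R ∘ₗ coeffs) h n‖ₑ) ≤ (κ⁻¹ * C : ℝ≥0) * ‖h‖ₑ :=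
    fun h => (hR _).trans (by
      rw [ENNReal.coe_mul, mul_assoc, Ell1.enorm_eq_normE]
      exact mul_le_mul_right (hC' h) _)
  let K := Ell1.codRestrict (R ∘ₗ S.DgamLin u) (κ⁻¹ * q) hK
  let R₀ := Ell1.codRestrict (R ∘ₗ coeffs) (κ⁻¹ * C) hR₀
  have hK1 : ‖-K‖ < 1 := by
    rw [norm_neg]
    refine (Ell1.norm_codRestrict_le _ _ hK).trans_lt ?_
    have : κ⁻¹ * q < 1 := by
      rwa [inv_mul_lt_iff₀ (pos_iff_ne_zero.2 hκ), mul_one]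
    exact_mod_cast this
  obtain ⟨V, hV⟩ := isUnit_one_sub_of_norm_lt_one hK1
  rw [sub_neg_eq_add] at hV
  let V' : Ell1 ν →L[ℂ] Ell1 ν := ↑V⁻¹
  have hV1 : ∀ h, V' h + K (V' h) = h := fun h => by
    have h1 : (V : Ell1 ν →L[ℂ] Ell1 ν) * V' = 1 := V.mul_inv
    rw [hV] at h1
    exact congrArg (fun f => f h) h1
  have hV2 : ∀ h, V' (h + K h) = h := fun h => by
    have h1 : V' * (V : Ell1 ν →L[ℂ] Ell1 ν) = 1 := V.inv_mul
    rw [hV] at h1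
    exact congrArg (fun f => f h) h1
  have hRL : ∀ h : Ell1 ν, R (S.DF u h - z • (h : ℤ → ℂ)) = (h + K h : Ell1 ν) := fun h => by
    rw [DF_sub_smul, map_add, S.conjDiag_inv_conjDiag fun n => (hz n).1]
    funext n
    rw [Ell1.add_apply, Ell1.codRestrict_apply]
    rfl
  -- R is invertible on arbitrary sequences, so it can be cancelled before anything is known about
  -- DF(u)h. The identity then shows that DF(u)h lies in ℓ¹_ν, i.e. h is in the domain.
  have hsol : ∀ f, S.DF u (V' (R₀ f)) = (f + z • V' (R₀ f) : Ell1 ν) := fun f => by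
    have h1 : R (S.DF u (V' (R₀ f)) - z • (V' (R₀ f) : ℤ → ℂ)) = R f := by
      rw [hRL, hV1]
      exact funext fun n => Ell1.codRestrict_apply _ _ hR₀ f n
    have h2 := congrArg (S.conjDiag fun n => S.lam n - z) h1
    rw [S.conjDiag_conjDiag_inv fun n => (hz n).1, S.conjDiag_conjDiag_inv fun n => (hz n).1,
      sub_eq_iff_eq_add] at h2
    rw [h2]
    rfl
  refine ⟨V' ∘L R₀, fun f => ⟨?_, ?_⟩, fun h => ?_⟩
  · change S.DF u (V' (R₀ f)) ∈ ell1Sub ν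
    rw [hsol]
    exact (f + z • V' (R₀ f)).2
  · refine Ell1.ext fun n => ?_
    rw [Ell1.sub_apply, linearization_apply]
    change S.DF u (V' (R₀ f)) n - _ = _
    rw [hsol]
    exact add_sub_cancel_right _ _
  · rw [ContinuousLinearMap.comp_apply]
    convert hV2 h
    refine Ell1.ext fun n => ?_
    rw [← hRL]
    exact Ell1.codRestrict_apply _ _ hR₀ _ n

theorem exists_unboundedSpectrum_subset (hN : S.IsBandwidth Nbar) (hG : S.IsLowBound Nbar G)
    {δ : ℝ} (hδ : 0 < δ) (h : ∀ n, δ ≤ -(S.lam n).re) {r rs : ℝ} (hr : 0 ≤ r) (hrs : r ≤ rs)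
    (hcontr : S.Z Nbar G + S.W rs * ENNReal.ofReal r < 1) {u : Ell1 ν}
    (hu : ‖u - S.ubar‖ ≤ r) :
    ∃ α : ℝ, α < 0 ∧ unboundedSpectrum (S.linearization u) ⊆ {z : ℂ | z.re < α} := by
  have hq := S.resNorm_Dgam_le hN hG hr hrs hu
  lift S.Z Nbar G + S.W rs * ENNReal.ofReal r to ℝ≥0 using hcontr.ne_top with q
  -- κ > q makes the Neumann series converge, and κ < 1 makes α = -(1-κ)δ strictly negative.
  obtain ⟨κ, hqκ, hκ1⟩ := exists_between (ENNReal.coe_lt_one_iff.1 hcontr)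
  have hκ : (0 : ℝ) < κ := (zero_le.trans_lt hqκ : 0 < κ)
  have hκ1' : (κ : ℝ) < 1 := hκ1
  refine ⟨-((1 - κ) * δ), neg_lt_zero.2 (mul_pos (sub_pos.2 hκ1') hδ), fun z hz => ?_⟩
  by_contra hzα
  refine hz (S.mem_unboundedResolventSet (fun n => by linarith [h n]) hqκ (fun n => ?_) hq)
  have := S.enorm_inv_lam_sub_le hδ hκ hκ1'.le h (not_lt.1 hzα) n
  rwa [ENNReal.ofReal_coe_nnreal] at this

end Setup

end Parabolic

end

theorem mainTheorem5 (ν : ℝ) [Fact (1 ≤ ν)] (S : Parabolic.Setup ν) (uin : Parabolic.Ell1 ν)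
    (hL : ∀ μ : ℂ, S.IsEigenvalueL μ → μ.re < 0)
    (Nbar : ℕ) (hNbar : S.IsBandwidth Nbar)
    (G : ℤ → ℤ → NNReal) (hG : S.IsLowBound Nbar G)
    (r rs : ℝ) (hr : 0 < r) (hrs : r < rs)
    (hself : S.Y uin + S.Z Nbar G * ENNReal.ofReal r + S.W rs * ENNReal.ofReal r ^ 2 / 2
      ≤ ENNReal.ofReal r)
    (hcontr : S.Z Nbar G + S.W rs * ENNReal.ofReal r < 1) :
    ∃ ustat : Parabolic.Ell1 ν,
      (S.IsSteadyState ustat ∧ ‖ustat - S.ubar‖ ≤ r) ∧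
      (∀ v : Parabolic.Ell1 ν, S.IsSteadyState v → ‖v - S.ubar‖ ≤ r → v = ustat) ∧
      ∃ α : ℝ, α < 0 ∧
        Parabolic.unboundedSpectrum (S.linearization ustat) ⊆ {z : ℂ | z.re < α} := by
  obtain ⟨δ, hδ, h⟩ := S.exists_le_neg_re_lam fun n => hL _ (S.isEigenvalueL_lam n)
  obtain ⟨u, hu, huniq⟩ :=
    S.existsUnique_isSteadyState hNbar hG hδ h uin hr hrs hself hcontr
  exact ⟨u, hu, fun v h1 h2 => huniq v ⟨h1, h2⟩,
    S.exists_unboundedSpectrum_subset hNbar hG hδ h hr.le hrs.le hcontr hu.2⟩
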